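/- Let $n,p\ge 1$, $m\ge 0$ be integers. Consider the system $$x^{(n)}(t)=F(\xi(t))\,\theta+\sigma(t)+u'(t),\qquad t\ge 0,$$ where $x(t)\in\mathbb R^p$, $\xi=(x^{(n-1)},\dots,\dot x,x)$, $F:\mathbb R^{np}\to\mathbb R^{p\times m}$ is locally Lipschitz, $\theta\in\mathbb R^m$ is an unknown constant vector, and the excitation $\sigma:[0,\infty)\to\mathbb R^p$ is continuous and bounded (for instance harmonic, or zero). A *response to $\sigma$* is a function $x^*$ of class $C^n$ on $[0,\infty)$ with $x^{*(n)}=F(\xi^*)\theta+\sigma$, where $\xi^*=(x^{*(n-1)},\dots,\dot x^*,x^*)$. Let $x^r$ be a reference of class $C^n$ on $[0,\infty)$ such that $\xi^r=(x^{r(n-1)},\dots,\dot x^r,x^r)$ is bounded. Let $k,\kappa,\epsilon,\gamma>0$, let $S\in\mathbb R^{m\times m}$ be symmetric positive definite, and let $\lambda_1,\dots,\lambda_{n-1}>0$ be such that $s^{n-1}+\lambda_{n-1}s^{n-2}+\dots+\lambda_2s+\lambda_1$ is Hurwitz stable. Put $e=x-x^r$ and $y=e^{(n-1)}+\lambda_{n-1}e^{(n-2)}+\dots+\lambda_1e$,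 let $\mathrm{sat}(y/\epsilon)$ be the vector with entries $\max(-1,\min(1,y_i/\epsilon))$, and define the controller, in which $\theta$ does not occur, by $$u'=-k\,\widetilde z+\eta,\qquad \widetilde z(t)=z(t)-x^{r(n-1)}(0),\qquad z(t)=x^{(n-1)}(t)-\int_0^t\big(F(\xi)\hat\theta+\sigma+\eta\big)\,d\tau,$$ $$\eta=-\lambda_{n-1}e^{(n-1)}-\dots-\lambda_1\dot e-\phi\,y-g\,\mathrm{sat}(y/\epsilon),\qquad g=\big\|(F(\xi)-F(\xi^r))\hat\theta\big\|+\kappa,$$ $$\dot\phi=\gamma\,y^\top y,\qquad \dot{\hat\theta}=S\,F(\xi)^\top\widetilde z .$$ For all initial values $\xi(0)\in\mathbb R^{np}$, $\hat\theta(0)\in\mathbb R^m$, $\phi(0)\in\mathbb R$ the closed loop has a solution on all of $[0,\infty)$, and every solution of the closed loop on $[0,\infty)$ has the following properties. 1. If $\xi^r=\xi^*$ on $[0,\infty)$ for some response $x^*$ to $\sigma$, then $\lim_{t\to\infty}(\xi(t)-\xi^*(t))=0$, and $u'$ is bounded on $[0,\infty)$ with $\lim_{t\to\infty}u'(t)=0$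 (the control is noninvasive). 2. If $x^r$ is not a response to $\sigma$, then $\xi$ is bounded on $[0,\infty)$. Moreover, any equilibrium of the tracking error system (stable or not) has nonzero tracking error and nonzero control input: if $(e,\dot e,\dots,e^{(n-1)})$ and the auxiliary error $\widetilde z$ are constant on $[0,\infty)$, then $(e,\dot e,\dots,e^{(n-1)})\neq 0$ and $u'$ is not identically zero on $[0,\infty)$. The control input $u'$ is not identically zero on $[0,\infty)$ even if only $(e,\dot e,\dots,e^{(n-1)})$ is constant. -/

import Mathlib

open Set Filter Topology
open scoped Matrix

namespace AdaptiveTracking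

/-- Column vectors with the Euclidean norm. -/
abbrev Vec (p : ℕ) : Type := EuclideanSpace ℝ (Fin p)

/-- The values of a stacked state `ξ`; the block with index `i` is the `i`-th derivative of `x`. -/
abbrev State (n p : ℕ) : Type := Fin n → Vec p

/-- Matrix times column vector. -/
noncomputable def mv {a b : ℕ} (A : Matrix (Fin a) (Fin b) ℝ) (v : Vec b) : Vec a :=
  WithLp.toLp 2 (A *ᵥ v.ofLp)

/-- The `j`-th derivative `x^{(j)}(t)` of a signal on the time axis `[0, ∞)`
(one-sided at `t = 0`). -/
noncomputable def der {p : ℕ} (j : ℕ) (x : ℝ → Vec p) (t : ℝ) : Vec p :=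
  iteratedDerivWithin j x (Ici 0) t

/-- The stacked state `ξ(t) = (x(t), x'(t), …, x^{(n-1)}(t))` of a signal `x`. -/
noncomputable def state {p : ℕ} (n : ℕ) (x : ℝ → Vec p) (t : ℝ) : State n p :=
  fun i => der (i : ℕ) x t

/-- A signal is bounded on `[0, ∞)`. -/
def BoundedSignal {E : Type*} [Norm E] (v : ℝ → E) : Prop :=
  ∃ M : ℝ, ∀ t : ℝ, 0 ≤ t → ‖v t‖ ≤ M

/-- The scalar saturation function with thresholds `± 1`. -/
noncomputable def sat (v : ℝ) : ℝ :=
  if 1 ≤ v then 1 else if v ≤ -1 then -1 else v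

/-- `sat(y / ε)`, entry by entry. -/
noncomputable def satVec {p : ℕ} (ε : ℝ) (y : Vec p) : Vec p :=
  WithLp.toLp 2 fun i => sat (y i / ε)

/-- The control parameters; `lam i` is the coefficient `λ_{i+1}`, for `i = 0, …, n - 2`. -/
structure Params (n m : ℕ) where
  k : ℝ
  κ : ℝ
  ε : ℝ
  γ : ℝ
  lam : Fin (n - 1) → ℝ
  S : Matrix (Fin m) (Fin m) ℝ

/-- The requirements on the control parameters. -/
structure Params.Admissible {n m : ℕ} (C : Params n m) : Prop where
  k_pos : 0 < C.k
  κ_pos : 0 < C.κ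
  ε_pos : 0 < C.ε
  γ_pos : 0 < C.γ
  lam_pos : ∀ i, 0 < C.lam i
  /-- `s^{n-1} + λ_{n-1} s^{n-2} + ⋯ + λ_2 s + λ_1` is Hurwitz stable. -/
  hurwitz : ∀ s : ℂ, s ^ (n - 1) + ∑ i : Fin (n - 1), (C.lam i : ℂ) * s ^ (i : ℕ) = 0 → s.re < 0
  S_posDef : C.S.PosDef

/-- `x` is a response of the uncontrolled system `x^{(n)} = F(ξ) θ + σ`. -/
structure IsResponse {n p m : ℕ} (F : State n p → Matrix (Fin p) (Fin m) ℝ) (θ : Vec m)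
    (σ : ℝ → Vec p) (x : ℝ → Vec p) : Prop where
  contDiffOn : ContDiffOn ℝ n x (Ici 0)
  ode : ∀ t : ℝ, 0 ≤ t → der n x t = mv (F (state n x t)) θ + σ t

section Controller

-- The controller uses `F`, `σ`, the reference `r` and measurements of `x`, but not `θ`.
variable {n p m : ℕ} (F : State n p → Matrix (Fin p) (Fin m) ℝ) (σ : ℝ → Vec p)
  (C : Params n m) (r x : ℝ → Vec p) (θhat : ℝ → Vec m) (φ : ℝ → ℝ)

/-- The tracking error `e = x - x^r`. -/
noncomputable def err (r x : ℝ → Vec p) : ℝ → Vec p := fun t => x t - r t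

/-- The sliding variable `y = e^{(n-1)} + λ_{n-1} e^{(n-2)} + ⋯ + λ_1 e`. -/
noncomputable def sliding (t : ℝ) : Vec p :=
  der (n - 1) (err r x) t + ∑ i : Fin (n - 1), C.lam i • der (i : ℕ) (err r x) t

/-- The gain `g = ‖(F(ξ) - F(ξ^r)) θhat‖ + κ`. -/
noncomputable def gain (t : ℝ) : ℝ :=
  ‖mv (F (state n x t) - F (state n r t)) (θhat t)‖ + C.κ

/-- `η = -λ_{n-1} e^{(n-1)} - ⋯ - λ_1 e' - φ y - g sat(y / ε)`. -/
noncomputable def eta (t : ℝ) : Vec p :=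
  -(∑ i : Fin (n - 1), C.lam i • der ((i : ℕ) + 1) (err r x) t)
    - φ t • sliding C r x t
    - gain F C r x θhat t • satVec C.ε (sliding C r x t)

/-- The auxiliary state `z(t) = x^{(n-1)}(t) - ∫₀ᵗ (F(ξ) θhat + σ + η)`. -/
noncomputable def aux (t : ℝ) : Vec p :=
  der (n - 1) x t
    - ∫ τ in (0 : ℝ)..t, (mv (F (state n x τ)) (θhat τ) + σ τ + eta F C r x θhat φ τ)

/-- The auxiliary error `z(t) - x^{r(n-1)}(0)`. -/
noncomputable def auxErr (t : ℝ) : Vec p :=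
  aux F σ C r x θhat φ t - der (n - 1) r 0

/-- The control input `u' = -k (z - x^{r(n-1)}(0)) + η`. -/
noncomputable def control (t : ℝ) : Vec p :=
  -(C.k • auxErr F σ C r x θhat φ t) + eta F C r x θhat φ t

/-- `(x, θhat, φ)` is a motion, on `[0, ∞)`, of the plant `x^{(n)} = F(ξ) θ + σ + u'`
with the adaptive controller in the loop. -/
structure IsClosedLoop (θ : Vec m) : Prop where
  contDiffOn : ContDiffOn ℝ n x (Ici 0)
  plant : ∀ t : ℝ, 0 ≤ t →
    der n x t = mv (F (state n x t)) θ + (σ t + control F σ C r x θhat φ t)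
  gain_update : ∀ t : ℝ, 0 ≤ t →
    HasDerivWithinAt φ (C.γ * inner ℝ (sliding C r x t) (sliding C r x t)) (Ici 0) t
  estimate_update : ∀ t : ℝ, 0 ≤ t →
    HasDerivWithinAt θhat (mv C.S (mv (F (state n x t))ᵀ (auxErr F σ C r x θhat φ t))) (Ici 0) t

/-- The motion rests at the point `(ebar, zbar)` of the tracking error system, whose state is the
tracking error with its derivatives up to order `n - 1` together with the auxiliary error; the
adaptive quantities `θhat` and `φ` are time-varying coefficients of that system and need not
be at rest. -/
def IsErrorEquilibrium (ebar : State n p) (zbar : Vec p) : Prop :=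
  ∀ t : ℝ, 0 ≤ t → state n (err r x) t = ebar ∧ auxErr F σ C r x θhat φ t = zbar

end Controller

end AdaptiveTracking

namespace AdaptiveTracking

/-! ### Comparison and Barbalat-type lemmas on `[0, ∞)` -/

section Calculus

/-! Write `Z` for the auxiliary error, `Θ` and `Φ` for the adaptive gains, `E = X - ρ` for the
stacked tracking error and `y` for the sliding variable. Differentiating `z` removes the integral:
`Z' = F(X)(θ - Θ) - kZ`. The estimator is chosen so that `H = ‖Z‖² + (Θ - θ)ᵀ S⁻¹ (Θ - θ)` has
derivative `-2k‖Z‖²`, whatever the reference (`exists_energy`). Hence `Z` and `Θ` are always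
bounded.

Boundedness of the state. In `w = y + ρ_d - Z`, where `d = n - 1`, both `θ` and `x^{r(n)}` cancel
(`Motion.hasDerivWithinAt_shifted`), and `w - y` is bounded. The only term of `w'` without an a
priori bound or a damping sign is `(F(X) - F(ρ))Θ`. Where `y_j ≥ ε` the gain `g` dominates it,
leaving `w_j' ≤ b - Φ y_j` with `Φ' ≥ γ y_j²`. Either `Φ` is large and damps `w_j`, or `Φ` is
growing fast; `w_j - a arctan Φ` captures both cases (`le_of_adaptive_damping`). So `y` is bounded,
and the Hurwitz condition turns this into a bound on `E` (`exists_lyapunov_of_hurwitz`). All these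
bounds are independent of the time interval, and `Φ` grows at most linearly, so solutions continue
for all time (`exists_hasDerivWithinAt_Ici_of_bound`).

Natural references. If the reference is a response, `y' = (F(X) - F(ρ))θ - kZ - Φy - g sat(y/ε)`,
and on the bounded set of states the first term is `O(‖E‖)`. With the Lyapunov function `V` of the
error cascade, a weighted sum of `‖y‖²`, `V`, `H` and `(Φ - Ψ)²` decreases at least at the rate `V +
‖y‖² + ‖Z‖²` when `Ψ` is large. This rate has derivative bounded above, so it tends to zero, and `Φ`
stays bounded. Since `‖u'‖ ≤ k‖Z‖ + A‖E‖`, the control dies out with the errors.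

Other references. If `E` is constant, its blocks beyond the zeroth vanish. If moreover `u' = 0`,
then `y ≠ 0` would make `Φ` grow linearly although `u' = 0` bounds `Φ` above, while `y = 0` gives `E
= 0` because `λ_1 > 0`, so the reference would solve the uncontrolled equation. At an equilibrium
with `E = 0` one has `Z = 0` as well, because `Z(0) = e^{(n-1)}(0)`; then `u' = 0`, which was just
excluded. -/

theorem sub_le_mul_sub_of_hasDerivWithinAt_le {f f' : ℝ → ℝ} {a b c : ℝ} (hab : a ≤ b)
    (hf : ∀ t ∈ Icc a b, HasDerivWithinAt f (f' t) (Icc a b) t)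
    (hc : ∀ t ∈ Ioo a b, f' t ≤ c) : f b - f a ≤ c * (b - a) := by
  have hd : ∀ t ∈ Ioo a b, HasDerivAt f (f' t) t := fun t ht =>
    (hf t (Ioo_subset_Icc_self ht)).hasDerivAt (Icc_mem_nhds ht.1 ht.2)
  refine Convex.image_sub_le_mul_sub_of_deriv_le (convex_Icc a b)
    (fun t ht => (hf t ht).continuousWithinAt) ?_ ?_ a (left_mem_Icc.2 hab) b
    (right_mem_Icc.2 hab) hab
  · rw [interior_Icc]
    exact fun t ht => (hd t ht).differentiableAt.differentiableWithinAt
  · rw [interior_Icc]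
    intro t ht
    rw [(hd t ht).deriv]
    exact hc t ht

/-- After the last time before a supposed violation at which `G ≤ K`, the function stays above `K`
and so cannot increase. The sign of the derivative matters only above the level `K`. -/
theorem le_of_hasDerivWithinAt_nonpos_above {G G' : ℝ → ℝ} {τ K : ℝ}
    (hG : ∀ t ∈ Icc 0 τ, HasDerivWithinAt G (G' t) (Icc 0 τ) t) (h0 : G 0 ≤ K)
    (hK : ∀ t ∈ Icc 0 τ, K < G t → G' t ≤ 0) : ∀ t ∈ Icc 0 τ, G t ≤ K := by
  intro t ht
  by_contra! hlt
  have hcont : ContinuousOn G (Icc 0 t) := fun s hs =>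
    ((hG s ⟨hs.1, hs.2.trans ht.2⟩).continuousWithinAt).mono (Icc_subset_Icc_right ht.2)
  have hcl : IsClosed (Icc 0 t ∩ G ⁻¹' Iic K) :=
    hcont.preimage_isClosed_of_isClosed isClosed_Icc isClosed_Iic
  have hcpt : IsCompact (Icc 0 t ∩ G ⁻¹' Iic K) :=
    isCompact_Icc.of_isClosed_subset hcl inter_subset_left
  obtain ⟨s, ⟨hs, hsK⟩, hmax⟩ := hcpt.exists_isGreatest ⟨0, ⟨left_mem_Icc.2 ht.1, h0⟩⟩
  have hsub : Icc s t ⊆ Icc 0 τ := Icc_subset_Icc hs.1 ht.2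
  have := sub_le_mul_sub_of_hasDerivWithinAt_le (f := G) (f' := G') (c := 0) hs.2
    (fun u hu => (hG u (hsub hu)).mono hsub) (fun u hu => by
      refine hK u (hsub (Ioo_subset_Icc_self hu)) ?_
      by_contra! hle
      exact absurd (hmax ⟨⟨hs.1.trans hu.1.le, hu.2.le⟩, hle⟩) (not_le.2 hu.1))
  have hsK' : G s ≤ K := hsK
  linarith

/-- A one-sided form of Barbalat's lemma. -/
theorem tendsto_zero_of_hasDerivWithinAt_le {f f' N N' : ℝ → ℝ} {K : ℝ}
    (hf : ∀ t ∈ Ici (0 : ℝ), HasDerivWithinAt f (f' t) (Ici 0) t)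
    (hN : ∀ t ∈ Ici (0 : ℝ), HasDerivWithinAt N (N' t) (Ici 0) t)
    (hf0 : ∀ t ∈ Ici (0 : ℝ), 0 ≤ f t) (hN0 : ∀ t ∈ Ici (0 : ℝ), 0 ≤ N t)
    (hfK : ∀ t ∈ Ici (0 : ℝ), f' t ≤ K) (hNf : ∀ t ∈ Ici (0 : ℝ), N' t ≤ -f t) :
    Tendsto f atTop (𝓝 0) := by
  obtain ⟨K, hKpos, hfK⟩ : ∃ K : ℝ, 0 < K ∧ ∀ t ∈ Ici (0 : ℝ), f' t ≤ K :=
    ⟨max K 1, by positivity, fun t ht => (hfK t ht).trans (le_max_left _ _)⟩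
  have hsub : ∀ {a b : ℝ}, 0 ≤ a → Icc a b ⊆ Ici 0 := fun ha u hu => ha.trans hu.1
  have hfd : ∀ a b, 0 ≤ a → a ≤ b → f b - f a ≤ K * (b - a) := fun a b ha hab =>
    sub_le_mul_sub_of_hasDerivWithinAt_le hab (fun t ht => (hf t (hsub ha ht)).mono (hsub ha))
      (fun t ht => hfK t (ha.trans ht.1.le))
  have hNanti : ∀ a b, 0 ≤ a → a ≤ b → N b ≤ N a := fun a b ha hab => by
    have := sub_le_mul_sub_of_hasDerivWithinAt_le (c := 0) hab
      (fun t ht => (hN t (hsub ha ht)).mono (hsub ha))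
      (fun t ht => (hNf t (ha.trans ht.1.le)).trans (neg_nonpos.2 (hf0 t (ha.trans ht.1.le))))
    linarith
  -- Extending `N` by a constant to negative times gives a function that is antitone on all of `ℝ`,
  -- hence convergent.
  set M : ℝ → ℝ := fun t => N (max t 0)
  have hM : Antitone M := fun a b hab =>
    hNanti _ _ (le_max_right _ _) (max_le_max_right _ hab)
  have hMb : BddBelow (range M) := ⟨0, by rintro _ ⟨t, rfl⟩; exact hN0 _ (mem_Ici.2 (le_max_right _ _))⟩
  have hlim := tendsto_atTop_ciInf hM hMb
  rw [Metric.tendsto_atTop]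
  intro δ hδ
  -- If `f t ≥ δ`, the bound `f' ≤ K` keeps `f ≥ δ/2` on `[t - h, t]`, so `N` drops there by at
  -- least `δh/2`. Two values of `N` within `δh/4` of the limit cannot differ by that much.
  set h := δ / (2 * K)
  have hh : 0 < h := by positivity
  have hKh : K * h = δ / 2 := by simp only [h]; field_simp
  have hev := (Metric.tendsto_atTop.1 hlim) (δ * h / 4) (by positivity)
  obtain ⟨T, hT⟩ := hev
  refine ⟨max T 0 + h, fun t ht => ?_⟩
  have ht0 : 0 ≤ t - h := by have := le_max_right T 0; linarith
  have htT : T ≤ t - h := by have := le_max_left T 0; linarith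
  rw [Real.dist_0_eq_abs, abs_of_nonneg (hf0 t (by simp; linarith))]
  by_contra! hge
  have h1 := hT (t - h) htT
  have h2 := hT t (by linarith)
  simp only [M, max_eq_left ht0, max_eq_left (show (0 : ℝ) ≤ t by linarith), Real.dist_eq] at h1 h2
  have h3 := sub_le_mul_sub_of_hasDerivWithinAt_le (f := N) (f' := N') (c := -(δ / 2))
    (show t - h ≤ t by linarith) (fun u hu => (hN u (hsub ht0 hu)).mono (hsub ht0))
    (fun u hu => by
      have hu0 : 0 ≤ u := ht0.trans hu.1.le
      have := hfd u t hu0 hu.2.le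
      have h5 : K * (t - u) ≤ K * h := by
        have := hu.1
        gcongr
        linarith
      have := hNf u hu0
      linarith)
  rw [abs_lt] at h1 h2
  nlinarith [mul_pos hδ hh]

end Calculus

/-! ### Global solutions from a priori bounds -/

section GlobalExistence

variable {E : Type*} [NormedAddCommGroup E] [NormedSpace ℝ E]

/-- The radial retraction onto the closed ball of radius `R` around the origin. -/
noncomputable def radialRetract (R : ℝ) (x : E) : E := (R / max R ‖x‖) • x

theorem radialRetract_of_le {R : ℝ} {x : E} (hR : 0 < R) (hx : ‖x‖ ≤ R) :
    radialRetract R x = x := by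
  rw [radialRetract, max_eq_left hx, div_self hR.ne', one_smul]

theorem norm_radialRetract_le {R : ℝ} (hR : 0 < R) (x : E) : ‖radialRetract R x‖ ≤ R := by
  have hm : 0 < max R ‖x‖ := lt_max_of_lt_left hR
  rw [radialRetract, norm_smul, Real.norm_of_nonneg (by positivity), div_mul_eq_mul_div,
    div_le_iff₀ hm]
  gcongr
  exact le_max_right _ _

/-- The change of the point and the change of the scaling factor each contribute at most `‖x - y‖`,
in any normed space. -/
theorem lipschitzWith_radialRetract {R : ℝ} (hR : 0 < R) :
    LipschitzWith 2 (radialRetract R : E → E) := by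
  refine LipschitzWith.of_dist_le_mul fun x y => ?_
  set a := max R ‖x‖ with ha
  set b := max R ‖y‖ with hb
  have hap : 0 < a := lt_max_of_lt_left hR
  have hbp : 0 < b := lt_max_of_lt_left hR
  have hab : |b - a| ≤ ‖x - y‖ := by
    rw [abs_sub_comm]
    calc |a - b| ≤ |‖x‖ - ‖y‖| := by
          have := abs_max_sub_max_le_max R ‖x‖ R ‖y‖
          simpa using this
      _ ≤ ‖x - y‖ := abs_norm_sub_norm_le x y
  have key : radialRetract R x - radialRetract R y =
      (R / a) • (x - y) + (R / a * ((b - a) / b)) • y := by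
    simp only [radialRetract, ← ha, ← hb]
    rw [smul_sub, sub_add, sub_right_inj, ← sub_smul]
    congr 1
    field_simp
    ring
  rw [dist_eq_norm, dist_eq_norm, key]
  have h1 : R / a ≤ 1 := (div_le_one hap).2 (le_max_left _ _)
  have h2 : ‖y‖ / b ≤ 1 := (div_le_one hbp).2 (le_max_right _ _)
  have h0 : 0 ≤ R / a := by positivity
  calc ‖(R / a) • (x - y) + (R / a * ((b - a) / b)) • y‖
      ≤ R / a * ‖x - y‖ + R / a * (|b - a| / b) * ‖y‖ := by
        refine (norm_add_le _ _).trans (le_of_eq ?_)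
        rw [norm_smul, norm_smul, Real.norm_of_nonneg h0, Real.norm_eq_abs, abs_mul,
          abs_of_nonneg h0, abs_div, abs_of_pos hbp]
    _ = R / a * (‖x - y‖ + |b - a| * (‖y‖ / b)) := by ring
    _ ≤ 1 * (‖x - y‖ + ‖x - y‖ * 1) := by gcongr
    _ = ((2 : NNReal) : ℝ) * ‖x - y‖ := by simp; ring

variable [CompleteSpace E] {f : ℝ → E → E} {x₀ : E}

/-- Composed with the retraction onto the ball of radius `R + 1`, the field is bounded and globally
Lipschitz, so Picard–Lindelöf reaches all of `[0, T]` in one step. Up to the first time its norm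
reaches `R + 1` the solution solves the original equation and has norm at most `R`, so that time
never comes and the cutoff is never felt. -/
theorem exists_hasDerivWithinAt_Icc_of_bound {T : ℝ} (hT : 0 ≤ T)
    (hcont : ∀ x, ContinuousOn (f · x) (Ici 0))
    (hLip : ∀ R : ℝ, ∃ K, ∀ t ∈ Icc 0 T, LipschitzOnWith K (f t) (Metric.closedBall 0 R))
    {R : ℝ} (hbound : ∀ u : ℝ → E, ∀ τ ∈ Icc 0 T, u 0 = x₀ →
      (∀ t ∈ Icc 0 τ, HasDerivWithinAt u (f t (u t)) (Icc 0 τ) t) → ‖u τ‖ ≤ R) :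
    ∃ u : ℝ → E, u 0 = x₀ ∧ (∀ t ∈ Icc 0 T, ‖u t‖ ≤ R + 1) ∧
      ∀ t ∈ Icc 0 T, HasDerivWithinAt u (f t (u t)) (Icc 0 T) t := by
  -- On the degenerate interval `[0, 0]` every function is a solution, so the a priori bound applies
  -- to the initial value.
  have hx₀ : ‖x₀‖ ≤ R := hbound (fun _ => x₀) 0 (left_mem_Icc.2 hT) rfl (fun t ht => by
    rw [Icc_self, mem_singleton_iff] at ht
    subst ht
    rw [Icc_self]
    exact HasFDerivWithinAt.singleton)
  have hR : 0 < R + 1 := by have := norm_nonneg x₀; linarith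
  obtain ⟨K, hK⟩ := hLip (R + 1)
  have hmem : ∀ x : E, radialRetract (R + 1) x ∈ Metric.closedBall (0 : E) (R + 1) := fun x => by
    rw [mem_closedBall_zero_iff]; exact norm_radialRetract_le hR x
  obtain ⟨B, hB⟩ : ∃ B, ∀ t ∈ Icc 0 T, ‖f t 0‖ ≤ B :=
    isCompact_Icc.exists_bound_of_continuousOn ((hcont 0).mono Icc_subset_Ici_self)
  have hB0 : 0 ≤ B := (norm_nonneg _).trans (hB 0 (left_mem_Icc.2 hT))
  have hfb : ∀ t ∈ Icc 0 T, ∀ x : E, ‖f t (radialRetract (R + 1) x)‖ ≤ B + K * (R + 1) := by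
    intro t ht x
    have h1 := (hK t ht).dist_le_mul _ (hmem x) 0 (by simp [hR.le])
    rw [dist_eq_norm, dist_zero_right] at h1
    have h2 : (K : ℝ) * ‖radialRetract (R + 1) x‖ ≤ K * (R + 1) := by
      gcongr; exact norm_radialRetract_le hR x
    have h3 := norm_le_norm_add_norm_sub' (f t (radialRetract (R + 1) x)) (f t 0)
    have := hB t ht
    linarith
  set L : NNReal := ⟨B + K * (R + 1), by positivity⟩
  have hPL : IsPicardLindelof (fun t x => f t (radialRetract (R + 1) x))
      (⟨0, left_mem_Icc.2 hT⟩ : Icc 0 T) x₀ (L * ⟨T, hT⟩) 0 L (K * 2) := by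
    refine ⟨fun t ht => ?_, fun x _ => ?_, fun t ht x _ => hfb t ht x, ?_⟩
    · exact ((hK t ht).comp (lipschitzWith_radialRetract hR).lipschitzOnWith
        (fun x _ => hmem x))
    · exact (hcont _).mono Icc_subset_Ici_self
    · simp only [sub_zero, sub_self, max_eq_left hT, NNReal.coe_zero]
      exact le_rfl
  obtain ⟨u, hu0, hu⟩ := hPL.exists_eq_forall_mem_Icc_hasDerivWithinAt (x := x₀) (by simp)
  simp only at hu0
  have hcu : ContinuousOn u (Icc 0 T) := fun t ht => (hu t ht).continuousWithinAt
  have hlt : ∀ t ∈ Icc 0 T, ‖u t‖ < R + 1 := by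
    by_contra! hex
    obtain ⟨t₁, ht₁, hge₁⟩ := hex
    have hcl : IsClosed (Icc 0 T ∩ (fun t => ‖u t‖) ⁻¹' Ici (R + 1)) :=
      hcu.norm.preimage_isClosed_of_isClosed isClosed_Icc isClosed_Ici
    obtain ⟨τ, ⟨hτ, hge⟩, hmin⟩ := (isCompact_Icc.of_isClosed_subset hcl
      inter_subset_left).exists_isLeast ⟨t₁, ht₁, hge₁⟩
    have hge' : R + 1 ≤ ‖u τ‖ := hge
    have hbelow : ∀ t ∈ Icc 0 τ, t ≠ τ → ‖u t‖ < R + 1 := fun t ht hne => by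
      by_contra! hc
      exact hne (le_antisymm ht.2 (hmin ⟨⟨ht.1, ht.2.trans hτ.2⟩, hc⟩))
    have hτ0 : 0 < τ := by
      rcases hτ.1.eq_or_lt with h | h
      · rw [← h, hu0] at hge'; linarith
      · exact h
    have hle : ∀ t ∈ Icc 0 τ, ‖u t‖ ≤ R + 1 := by
      have hcl' : IsClosed (Icc 0 τ ∩ (fun t => ‖u t‖) ⁻¹' Iic (R + 1)) :=
        (hcu.mono (Icc_subset_Icc_right hτ.2)).norm.preimage_isClosed_of_isClosed
          isClosed_Icc isClosed_Iic
      have hsub : Ico 0 τ ⊆ Icc 0 τ ∩ (fun t => ‖u t‖) ⁻¹' Iic (R + 1) := fun t ht =>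
        ⟨Ico_subset_Icc_self ht, (hbelow t (Ico_subset_Icc_self ht) ht.2.ne).le⟩
      intro t ht
      have := hcl'.closure_subset_iff.2 hsub
      rw [closure_Ico hτ0.ne] at this
      exact (this ht).2
    have := hbound u τ hτ hu0 (fun t ht => by
      have := (hu t ⟨ht.1, ht.2.trans hτ.2⟩).mono (Icc_subset_Icc_right hτ.2)
      rwa [radialRetract_of_le hR (hle t ht)] at this)
    linarith
  refine ⟨u, hu0, fun t ht => (hlt t ht).le, fun t ht => ?_⟩
  have := hu t ht
  rwa [radialRetract_of_le hR (hlt t ht).le] at this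

/-- A locally Lipschitz differential equation whose solutions obey an a priori bound on bounded
time intervals has a solution for all future times. -/
theorem exists_hasDerivWithinAt_Ici_of_bound
    (hcont : ∀ x, ContinuousOn (f · x) (Ici 0))
    (hLip : ∀ T R : ℝ, ∃ K, ∀ t ∈ Icc 0 T, LipschitzOnWith K (f t) (Metric.closedBall 0 R))
    (hbound : ∀ T : ℝ, 0 ≤ T → ∃ R : ℝ, ∀ u : ℝ → E, ∀ τ ∈ Icc 0 T, u 0 = x₀ →
      (∀ t ∈ Icc 0 τ, HasDerivWithinAt u (f t (u t)) (Icc 0 τ) t) → ‖u τ‖ ≤ R) :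
    ∃ u : ℝ → E, u 0 = x₀ ∧ ∀ t ∈ Ici (0 : ℝ), HasDerivWithinAt u (f t (u t)) (Ici 0) t := by
  have hex : ∀ N : ℕ, ∃ u : ℝ → E, u 0 = x₀ ∧ (∃ R, ∀ t ∈ Icc (0 : ℝ) N, ‖u t‖ ≤ R) ∧
      ∀ t ∈ Icc (0 : ℝ) N, HasDerivWithinAt u (f t (u t)) (Icc 0 N) t := fun N => by
    obtain ⟨R, hR⟩ := hbound N N.cast_nonneg
    obtain ⟨u, h0, hb, hd⟩ := exists_hasDerivWithinAt_Icc_of_bound N.cast_nonneg hcont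
      (hLip N) hR
    exact ⟨u, h0, ⟨_, hb⟩, hd⟩
  choose u hu0 hub hud using hex
  have hagree : ∀ N M : ℕ, N ≤ M → EqOn (u N) (u M) (Icc 0 N) := by
    intro N M hNM
    have hNM' : (N : ℝ) ≤ M := Nat.cast_le.2 hNM
    obtain ⟨R₁, h₁⟩ := hub N
    obtain ⟨R₂, h₂⟩ := hub M
    obtain ⟨K, hK⟩ := hLip N (max R₁ R₂)
    have hright : ∀ (P : ℕ), N ≤ P → ∀ t ∈ Ico (0 : ℝ) N,
        HasDerivWithinAt (u P) (f t (u P t)) (Ici t) t := fun P hP t ht => by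
      have hP' : (N : ℝ) ≤ P := Nat.cast_le.2 hP
      have htP : t < P := ht.2.trans_le hP'
      exact ((hud P t ⟨ht.1, htP.le⟩).mono (Icc_subset_Icc_left ht.1)).mono_of_mem_nhdsWithin
        (Icc_mem_nhdsGE htP)
    refine ODE_solution_unique_of_mem_Icc_right (v := f)
      (s := fun _ => Metric.closedBall 0 (max R₁ R₂)) (K := K)
      (fun t ht => hK t (Ico_subset_Icc_self ht))
      (fun t ht => (hud N t ht).continuousWithinAt) (hright N le_rfl) ?_
      (fun t ht => ((hud M t ⟨ht.1, ht.2.trans hNM'⟩).continuousWithinAt).mono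
        (Icc_subset_Icc_right hNM')) (hright M hNM) ?_ ((hu0 N).trans (hu0 M).symm)
    · intro t ht
      rw [mem_closedBall_zero_iff]
      exact (h₁ t (Ico_subset_Icc_self ht)).trans (le_max_left _ _)
    · intro t ht
      rw [mem_closedBall_zero_iff]
      exact (h₂ t ⟨ht.1, ht.2.le.trans hNM'⟩).trans (le_max_right _ _)
  -- The extra `1` puts `t` strictly inside the interval, so that the derivative within `Icc 0 N` is
  -- also one within `Ici 0`.
  set v : ℝ → E := fun t => u (⌈t⌉₊ + 1) t
  have hv : ∀ N : ℕ, EqOn v (u N) (Icc 0 N) := by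
    intro N t ht
    rcases le_total N (⌈t⌉₊ + 1) with h | h
    · exact (hagree N _ h ht).symm
    · refine hagree _ N h ⟨ht.1, ?_⟩
      push_cast
      linarith [Nat.le_ceil t]
  refine ⟨v, ?_, fun t ht => ?_⟩
  · simp [v, hu0]
  · set N := ⌈t⌉₊ + 1
    have htN : t < N := by
      simp only [N]; push_cast; linarith [Nat.le_ceil t]
    have htI : t ∈ Icc (0 : ℝ) N := ⟨ht, htN.le⟩
    have h1 : HasDerivWithinAt v (f t (v t)) (Icc 0 N) t := by
      rw [hv N htI]
      exact (hud N t htI).congr (hv N) (hv N htI)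
    refine h1.mono_of_mem_nhdsWithin ?_
    rw [← Ici_inter_Iic]
    exact inter_mem self_mem_nhdsWithin (mem_nhdsWithin_of_mem_nhds (Iic_mem_nhds htN))

end GlobalExistence


/-! ### Lyapunov functions for the Hurwitz error dynamics -/

section Hurwitz

/-- The value at a sequence of the product of the difference operators `shift - μ`. -/
def shiftProd : List ℂ → (ℕ → ℂ) → ℂ
  | [], u => u 0
  | μ :: l, u => shiftProd l fun i => u (i + 1) - μ * u i

/-- The operators `shift - μ` are polynomials in one operator and commute, so their product depends
only on the polynomial with the given roots. This lets the cascade be traded for the characteristic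
polynomial. -/
theorem shiftProd_eq_aeval (l : List ℂ) (u : ℕ → ℂ) :
    shiftProd l u = Polynomial.aeval (LinearMap.funLeft ℂ ℂ Nat.succ)
      (l.map fun μ => Polynomial.X - Polynomial.C μ).prod u 0 := by
  induction l generalizing u with
  | nil => simp [shiftProd]
  | cons μ l ih =>
    rw [shiftProd, ih, List.map_cons, List.prod_cons, mul_comm, map_mul, Module.End.mul_apply]
    have : (fun i => u (i + 1) - μ * u i) = Polynomial.aeval (LinearMap.funLeft ℂ ℂ Nat.succ)
        (Polynomial.X - Polynomial.C μ) u := by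
      ext i
      simp [LinearMap.funLeft_apply, Module.algebraMap_end_apply]
    rw [this]

/-- A cascade of stable first-order filters has a quadratic Lyapunov function. -/
theorem exists_lyapunov_of_shiftProd (l : List ℂ) (hl : ∀ μ ∈ l, μ.re < 0) :
    ∃ a > 0, ∃ C > 0, ∀ (s : Set ℝ) (u : ℕ → ℝ → ℂ),
      (∀ i < l.length, ∀ t ∈ s, HasDerivWithinAt (u i) (u (i + 1) t) s t) →
      ∃ V V' : ℝ → ℝ, ∀ t ∈ s, HasDerivWithinAt V (V' t) s t ∧ 0 ≤ V t ∧
        V' t ≤ -a * V t + C * ‖shiftProd l fun i => u i t‖ ^ 2 ∧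
        (∀ i ≤ l.length, ‖u i t‖ ^ 2 ≤ C * (V t + ‖shiftProd l fun i => u i t‖ ^ 2)) ∧
        V t ≤ C * ∑ i ∈ Finset.range l.length, ‖u i t‖ ^ 2 := by
  induction l with
  | nil =>
    refine ⟨1, one_pos, 1, one_pos, fun s u _ => ⟨fun _ => 0, fun _ => 0, fun t _ => ?_⟩⟩
    refine ⟨hasDerivWithinAt_const _ _ _, le_rfl, by simp, ?_, by simp⟩
    intro i hi
    obtain rfl : i = 0 := by simpa using hi
    simp [shiftProd]
  | cons μ l ih =>
    obtain ⟨a₁, ha₁, C₁, hC₁, H⟩ := ih fun ν hν => hl ν (List.mem_cons_of_mem _ hν)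
    set α := -μ.re with hα
    have hαpos : 0 < α := by have := hl μ List.mem_cons_self; linarith
    -- The weight makes half of the decay `c a₁ V₁` equal to `(C₁/α) V₁`, the part of the cross term
    -- of `u 0` with `v 0` that Young's inequality leaves over; the other half survives as decay.
    set c := 2 * C₁ / (α * a₁) with hc
    have hcpos : 0 < c := by positivity
    have hca : c * a₁ = 2 * (C₁ / α) := by rw [hc]; field_simp
    set K := 1 / c + 1
    have hKpos : 0 < K := by positivity
    -- Growth factor per index when `u (i + 1) = v i + μ u i` is used to recover the `u i` from the
    -- `v i`.
    set M := 1 + 2 * C₁ * K + 2 * ‖μ‖ ^ 2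
    have hM1 : 1 ≤ M := by
      have : 0 ≤ 2 * C₁ * K + 2 * ‖μ‖ ^ 2 := by positivity
      simp only [M]; linarith
    set C₂ := C₁ / α + c * C₁
    set C₃ := c * (C₁ * (2 + 2 * ‖μ‖ ^ 2)) + 1
    refine ⟨min α (a₁ / 2), lt_min hαpos (by positivity), C₂ + C₃ + M ^ (l.length + 1),
      by positivity, fun s u hu => ?_⟩
    -- The first filter is `u 0' = μ u 0 + v 0`; the sequence `v` runs through the remaining filters
    -- and has the same final output.
    set v : ℕ → ℝ → ℂ := fun i t => u (i + 1) t - μ * u i t with hv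
    obtain ⟨V₁, V₁', hV⟩ := H s v fun i hi t ht =>
      (hu (i + 1) (by simpa using hi) t ht).sub
        ((hu i (by simp; omega) t ht).const_mul μ)
    refine ⟨fun t => c * V₁ t + ‖u 0 t‖ ^ 2,
      fun t => c * V₁' t + 2 * inner ℝ (u 0 t) (u 1 t), fun t ht => ?_⟩
    obtain ⟨hd, hV0, hV', hvb, hVu⟩ := hV t ht
    have hy : (shiftProd (μ :: l) fun i => u i t) = shiftProd l fun i => v i t := rfl
    rw [hy]
    set Y := ‖shiftProd l fun i => v i t‖ ^ 2
    have hY : 0 ≤ Y := by positivity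
    have hv0 : ‖v 0 t‖ ^ 2 ≤ C₁ * (V₁ t + Y) := hvb 0 (Nat.zero_le _)
    have hW : V₁ t + Y ≤ K * (c * V₁ t + ‖u 0 t‖ ^ 2 + Y) := by
      have e1 : K * (c * V₁ t + ‖u 0 t‖ ^ 2 + Y) =
          V₁ t + Y + (1 / c * (‖u 0 t‖ ^ 2 + Y) + (c * V₁ t + ‖u 0 t‖ ^ 2)) := by
        simp only [K]; field_simp; ring
      rw [e1]
      have : 0 ≤ 1 / c * (‖u 0 t‖ ^ 2 + Y) + (c * V₁ t + ‖u 0 t‖ ^ 2) := by positivity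
      linarith
    set W := c * V₁ t + ‖u 0 t‖ ^ 2 + Y with hWdef
    have hW0 : 0 ≤ W := by positivity
    have hC₂ : 0 < C₂ := by positivity
    have hC₃ : 0 < C₃ := by positivity
    have hMpos : 0 < M ^ (l.length + 1) := by positivity
    refine ⟨(hd.const_mul c).add (hu 0 (by simp) t ht).norm_sq, by positivity, ?_, ?_, ?_⟩
    · have hin : 2 * inner ℝ (u 0 t) (u 1 t) ≤ -α * ‖u 0 t‖ ^ 2 + ‖v 0 t‖ ^ 2 / α := by
        have e1 : u 1 t = μ * u 0 t + v 0 t := by simp [hv]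
        have e2 : inner ℝ (u 0 t) (μ * u 0 t) = -α * ‖u 0 t‖ ^ 2 := by
          rw [Complex.inner, mul_assoc, Complex.mul_conj, ← Complex.sq_norm, hα, neg_neg,
            Complex.re_mul_ofReal]
        have e3 := real_inner_le_norm (u 0 t) (v 0 t)
        have e4 : 2 * (‖u 0 t‖ * ‖v 0 t‖) ≤ α * ‖u 0 t‖ ^ 2 + ‖v 0 t‖ ^ 2 / α := by
          rw [← sub_nonneg]
          have : α * ‖u 0 t‖ ^ 2 + ‖v 0 t‖ ^ 2 / α - 2 * (‖u 0 t‖ * ‖v 0 t‖) =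
              (α * ‖u 0 t‖ - ‖v 0 t‖) ^ 2 / α := by field_simp; ring
          rw [this]; positivity
        rw [e1, inner_add_right, e2]
        linarith
      have h1 : ‖v 0 t‖ ^ 2 / α ≤ C₁ / α * (V₁ t + Y) := by
        rw [div_mul_eq_mul_div]; gcongr
      have h2 : c * V₁' t ≤ c * (-a₁ * V₁ t + C₁ * Y) := by gcongr
      have h3 : min α (a₁ / 2) * (c * V₁ t) ≤ a₁ / 2 * (c * V₁ t) := by
        gcongr; exact min_le_right _ _
      have h4 : min α (a₁ / 2) * ‖u 0 t‖ ^ 2 ≤ α * ‖u 0 t‖ ^ 2 := by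
        gcongr; exact min_le_left _ _
      have h5 : C₂ * Y ≤ (C₂ + C₃ + M ^ (l.length + 1)) * Y := by
        gcongr; linarith
      have h6 : a₁ / 2 * (c * V₁ t) = C₁ / α * V₁ t := by
        linear_combination (V₁ t / 2) * hca
      have h7 : c * (-a₁ * V₁ t + C₁ * Y) = -2 * (C₁ / α) * V₁ t + c * C₁ * Y := by
        linear_combination (-V₁ t) * hca
      have h8 : C₂ * Y = C₁ / α * Y + c * C₁ * Y := by simp only [C₂]; ring
      linarith
    · have hstep : ∀ i ≤ l.length + 1, ‖u i t‖ ^ 2 ≤ M ^ i * W := by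
        intro i
        induction i with
        | zero => intro _; rw [pow_zero, one_mul]; have : 0 ≤ c * V₁ t := by positivity
                  linarith
        | succ i ihi =>
          intro hi
          have h1 := ihi (by omega)
          have h2 : ‖v i t‖ ^ 2 ≤ C₁ * (K * W) :=
            (hvb i (by omega)).trans (by gcongr)
          have e1 : u (i + 1) t = v i t + μ * u i t := by simp [hv]
          have h3 : ‖u (i + 1) t‖ ^ 2 ≤ 2 * ‖v i t‖ ^ 2 + 2 * (‖μ‖ ^ 2 * ‖u i t‖ ^ 2) := by
            have h4 : ‖u (i + 1) t‖ ≤ ‖v i t‖ + ‖μ‖ * ‖u i t‖ := by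
              rw [e1, ← norm_mul]; exact norm_add_le _ _
            have h5 : ‖u (i + 1) t‖ ^ 2 ≤ (‖v i t‖ + ‖μ‖ * ‖u i t‖) ^ 2 := by gcongr
            nlinarith [sq_nonneg (‖v i t‖ - ‖μ‖ * ‖u i t‖)]
          have h6 : 1 ≤ M ^ i := one_le_pow₀ hM1
          have h7 : ‖μ‖ ^ 2 * ‖u i t‖ ^ 2 ≤ ‖μ‖ ^ 2 * (M ^ i * W) := by gcongr
          have h8 : C₁ * (K * W) * 1 ≤ C₁ * (K * W) * M ^ i := by gcongr
          have h9 : 0 ≤ M ^ i * W := by positivity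
          have h10 : M ^ (i + 1) * W =
              M ^ i * W + 2 * (C₁ * (K * W) * M ^ i) + 2 * (‖μ‖ ^ 2 * (M ^ i * W)) := by
            rw [pow_succ]
            simp only [M]; ring
          linarith
      intro i hi
      have hi' : i ≤ l.length + 1 := by simpa using hi
      refine (hstep i hi').trans ?_
      gcongr
      have : M ^ i ≤ M ^ (l.length + 1) := pow_le_pow_right₀ hM1 hi'
      linarith
    · rw [List.length_cons]
      set S := ∑ i ∈ Finset.range (l.length + 1), ‖u i t‖ ^ 2
      have hS1 : ∑ i ∈ Finset.range l.length, ‖u (i + 1) t‖ ^ 2 ≤ S := by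
        simp only [S]
        rw [Finset.sum_range_succ']
        have : 0 ≤ ‖u 0 t‖ ^ 2 := by positivity
        linarith
      have hS2 : ∑ i ∈ Finset.range l.length, ‖u i t‖ ^ 2 ≤ S := by
        simp only [S]
        rw [Finset.sum_range_succ]
        have : 0 ≤ ‖u l.length t‖ ^ 2 := by positivity
        linarith
      have hS3 : ‖u 0 t‖ ^ 2 ≤ S :=
        Finset.single_le_sum (f := fun i => ‖u i t‖ ^ 2) (fun i _ => by positivity)
          (Finset.mem_range.2 (Nat.succ_pos _))
      have hS0 : 0 ≤ S := by positivity
      have hvS : ∑ i ∈ Finset.range l.length, ‖v i t‖ ^ 2 ≤ (2 + 2 * ‖μ‖ ^ 2) * S := by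
        calc ∑ i ∈ Finset.range l.length, ‖v i t‖ ^ 2
            ≤ ∑ i ∈ Finset.range l.length,
              (2 * ‖u (i + 1) t‖ ^ 2 + 2 * ‖μ‖ ^ 2 * ‖u i t‖ ^ 2) := by
              refine Finset.sum_le_sum fun i _ => ?_
              have h4 : ‖v i t‖ ≤ ‖u (i + 1) t‖ + ‖μ‖ * ‖u i t‖ := by
                rw [← norm_mul]; exact norm_sub_le _ _
              have h5 : ‖v i t‖ ^ 2 ≤ (‖u (i + 1) t‖ + ‖μ‖ * ‖u i t‖) ^ 2 := by gcongr
              nlinarith [sq_nonneg (‖u (i + 1) t‖ - ‖μ‖ * ‖u i t‖)]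
          _ = 2 * ∑ i ∈ Finset.range l.length, ‖u (i + 1) t‖ ^ 2 +
              2 * ‖μ‖ ^ 2 * ∑ i ∈ Finset.range l.length, ‖u i t‖ ^ 2 := by
              rw [Finset.sum_add_distrib, ← Finset.mul_sum, ← Finset.mul_sum]
          _ ≤ 2 * S + 2 * ‖μ‖ ^ 2 * S := by gcongr
          _ = (2 + 2 * ‖μ‖ ^ 2) * S := by ring
      calc c * V₁ t + ‖u 0 t‖ ^ 2
          ≤ c * (C₁ * ((2 + 2 * ‖μ‖ ^ 2) * S)) + S := by
            gcongr
            exact hVu.trans (by gcongr)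
        _ = C₃ * S := by simp only [C₃]; ring
        _ ≤ _ := by gcongr; linarith

/-- The combination `E_d + ∑ λ_i E_i` of the blocks of a stacked vector. -/
noncomputable def slide {d p : ℕ} (lam : Fin d → ℝ) (E : State (d + 1) p) : Vec p :=
  E (Fin.last d) + ∑ i : Fin d, lam i • E i.castSucc

theorem slide_apply {d p : ℕ} (lam : Fin d → ℝ) (E : State (d + 1) p) (j : Fin p) :
    slide lam E j = E (Fin.last d) j + ∑ i : Fin d, lam i * E i.castSucc j := by
  simp [slide]

/-- Over `ℂ` the characteristic polynomial splits and its roots lie in the open left half plane;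
evaluating it at the shift recovers the original combination. -/
theorem exists_list_of_hurwitz {d : ℕ} (lam : Fin d → ℝ)
    (h : ∀ s : ℂ, s ^ d + ∑ i : Fin d, (lam i : ℂ) * s ^ (i : ℕ) = 0 → s.re < 0) :
    ∃ l : List ℂ, l.length = d ∧ (∀ μ ∈ l, μ.re < 0) ∧
      ∀ u : ℕ → ℂ, shiftProd l u = u d + ∑ i : Fin d, (lam i : ℂ) * u i := by
  set P : Polynomial ℂ := Polynomial.X ^ d +
    ∑ i : Fin d, Polynomial.C (lam i : ℂ) * Polynomial.X ^ (i : ℕ) with hP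
  have hdeg : (∑ i : Fin d, Polynomial.C (lam i : ℂ) * Polynomial.X ^ (i : ℕ)).degree <
      (d : WithBot ℕ) := Polynomial.degree_sum_fin_lt _
  have hmon : P.Monic := Polynomial.monic_X_pow_add hdeg
  have hnat : P.natDegree = d := by
    refine Polynomial.natDegree_eq_of_degree_eq_some ?_
    rw [hP, Polynomial.degree_add_eq_left_of_degree_lt, Polynomial.degree_X_pow]
    rwa [Polynomial.degree_X_pow]
  have hsplit := IsAlgClosed.splits P
  have hprod := hsplit.eq_prod_roots_of_monic hmon
  refine ⟨P.roots.toList, ?_, ?_, fun u => ?_⟩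
  · rw [Multiset.length_toList, ← hsplit.natDegree_eq_card_roots, hnat]
  · intro μ hμ
    rw [Multiset.mem_toList, Polynomial.mem_roots hmon.ne_zero, Polynomial.IsRoot.def] at hμ
    refine h μ ?_
    rw [← hμ, hP]
    simp [Polynomial.eval_finsetSum]
  · have hpow : ∀ i : ℕ, ((LinearMap.funLeft ℂ ℂ Nat.succ) ^ i) u 0 = u i := by
      have : ∀ (i : ℕ) (w : ℕ → ℂ) (j : ℕ),
          ((LinearMap.funLeft ℂ ℂ Nat.succ) ^ i) w j = w (j + i) := by
        intro i
        induction i with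
        | zero => simp
        | succ i ih =>
          intro w j
          rw [pow_succ, Module.End.mul_apply, ih, LinearMap.funLeft_apply]
          rfl
      intro i
      rw [this, zero_add]
    have : (P.roots.toList.map fun μ => Polynomial.X - Polynomial.C μ).prod = P := by
      conv_rhs => rw [hprod]
      rw [← Multiset.prod_coe, ← Multiset.map_coe, Multiset.coe_toList]
    rw [shiftProd_eq_aeval, this, hP]
    simp only [map_add, map_pow, map_sum, map_mul, Polynomial.aeval_X, Polynomial.aeval_C,
      LinearMap.add_apply, LinearMap.sum_apply, Module.End.mul_apply, Pi.add_apply,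
      Finset.sum_apply, Module.algebraMap_end_apply, Pi.smul_apply, smul_eq_mul, hpow]

theorem hasDerivWithinAt_coord {p : ℕ} {f : ℝ → Vec p} {f' : Vec p} {s : Set ℝ} {t : ℝ}
    (h : HasDerivWithinAt f f' s t) (j : Fin p) :
    HasDerivWithinAt (fun τ => f τ j) (f' j) s t :=
  (EuclideanSpace.proj (𝕜 := ℝ) j).hasFDerivAt.comp_hasDerivWithinAt t h

/-- A Lyapunov function for the error dynamics on the sliding manifold. -/
theorem exists_lyapunov_of_hurwitz {d : ℕ} (p : ℕ) (lam : Fin d → ℝ)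
    (h : ∀ s : ℂ, s ^ d + ∑ i : Fin d, (lam i : ℂ) * s ^ (i : ℕ) = 0 → s.re < 0) :
    ∃ a > 0, ∃ C > 0, ∀ (s : Set ℝ) (E : ℝ → State (d + 1) p),
      (∀ t ∈ s, ∀ i : Fin d,
        HasDerivWithinAt (fun τ => E τ i.castSucc) (E t i.succ) s t) →
      ∃ V V' : ℝ → ℝ, ∀ t ∈ s, HasDerivWithinAt V (V' t) s t ∧ 0 ≤ V t ∧
        V' t ≤ -a * V t + C * ‖slide lam (E t)‖ ^ 2 ∧
        ‖E t‖ ^ 2 ≤ C * (V t + ‖slide lam (E t)‖ ^ 2) ∧ V t ≤ C * ‖E t‖ ^ 2 := by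
  obtain ⟨l, hlen, hl, hlu⟩ := exists_list_of_hurwitz lam h
  obtain ⟨a, ha, C, hC, H⟩ := exists_lyapunov_of_shiftProd l hl
  refine ⟨a, ha, C * (d + 1), by positivity, fun s E hE => ?_⟩
  -- Each coordinate is treated separately as a complex scalar cascade, since the roots are complex.
  -- The padding value `0` beyond index `d` is never used.
  set u : Fin p → ℕ → ℝ → ℂ := fun j i t =>
    if hi : i < d + 1 then ((E t ⟨i, hi⟩ j : ℝ) : ℂ) else 0 with hu
  have hu_of : ∀ j (i : Fin (d + 1)) t, u j i t = ((E t i j : ℝ) : ℂ) := fun j i t => by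
    simp only [hu, dif_pos i.2]
  have hu_cast : ∀ j (i : Fin d) t, u j i t = ((E t i.castSucc j : ℝ) : ℂ) := fun j i t => by
    rw [← hu_of]; simp
  have hu_last : ∀ j t, u j d t = ((E t (Fin.last d) j : ℝ) : ℂ) := fun j t => by
    rw [← hu_of]; simp
  have hy : ∀ j t, (shiftProd l fun i => u j i t) = ((slide lam (E t) j : ℝ) : ℂ) := by
    intro j t
    rw [hlu, slide_apply, hu_last]
    push_cast
    simp only [hu_cast]
  have hV : ∀ j, ∃ V V' : ℝ → ℝ, ∀ t ∈ s, HasDerivWithinAt V (V' t) s t ∧ 0 ≤ V t ∧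
        V' t ≤ -a * V t + C * ‖shiftProd l fun i => u j i t‖ ^ 2 ∧
        (∀ i ≤ l.length, ‖u j i t‖ ^ 2 ≤ C * (V t + ‖shiftProd l fun i => u j i t‖ ^ 2)) ∧
        V t ≤ C * ∑ i ∈ Finset.range l.length, ‖u j i t‖ ^ 2 := fun j => by
    refine H s (u j) fun i hi t ht => ?_
    rw [hlen] at hi
    have h1 := (hasDerivWithinAt_coord (hE t ht ⟨i, hi⟩) j).ofReal_comp
    have e1 : u j (i + 1) t = ((E t (Fin.succ ⟨i, hi⟩) j : ℝ) : ℂ) := by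
      rw [← hu_of]; rfl
    have e2 : u j i = fun t => ((E t (Fin.castSucc ⟨i, hi⟩) j : ℝ) : ℂ) := by
      funext t; exact hu_cast j ⟨i, hi⟩ t
    rw [e1, e2]
    exact h1
  choose V V' hV using hV
  have hyn : ∀ t, ‖slide lam (E t)‖ ^ 2 = ∑ j, ‖shiftProd l fun i => u j i t‖ ^ 2 := fun t => by
    rw [EuclideanSpace.norm_sq_eq]
    simp only [hy, Complex.norm_real]
  refine ⟨fun t => ∑ j, V j t, fun t => ∑ j, V' j t, fun t ht => ⟨?_, ?_, ?_, ?_, ?_⟩⟩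
  · exact HasDerivWithinAt.fun_sum fun j _ => (hV j t ht).1
  · exact Finset.sum_nonneg fun j _ => (hV j t ht).2.1
  · calc ∑ j, V' j t ≤ ∑ j, (-a * V j t + C * ‖shiftProd l fun i => u j i t‖ ^ 2) :=
          Finset.sum_le_sum fun j _ => (hV j t ht).2.2.1
      _ = -a * ∑ j, V j t + C * ‖slide lam (E t)‖ ^ 2 := by
          rw [Finset.sum_add_distrib, ← Finset.mul_sum, ← Finset.mul_sum, hyn]
      _ ≤ -a * ∑ j, V j t + C * (d + 1) * ‖slide lam (E t)‖ ^ 2 := by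
          gcongr
          have : (0 : ℝ) ≤ d := d.cast_nonneg
          nlinarith
  · have hV0 : 0 ≤ ∑ j, V j t := Finset.sum_nonneg fun j _ => (hV j t ht).2.1
    have hi : ∀ i, ‖E t i‖ ^ 2 ≤ C * (∑ j, V j t + ‖slide lam (E t)‖ ^ 2) := fun i => by
      rw [hyn, ← Finset.sum_add_distrib, Finset.mul_sum, EuclideanSpace.norm_sq_eq]
      refine Finset.sum_le_sum fun j _ => ?_
      have := (hV j t ht).2.2.2.1 i (by rw [hlen]; omega)
      rwa [hu_of, Complex.norm_real] at this
    have h0 : 0 ≤ C * (∑ j, V j t + ‖slide lam (E t)‖ ^ 2) := by positivity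
    have h1 : ‖E t‖ ≤ √(C * (∑ j, V j t + ‖slide lam (E t)‖ ^ 2)) :=
      (pi_norm_le_iff_of_nonneg (Real.sqrt_nonneg _)).2 fun i => Real.le_sqrt_of_sq_le (hi i)
    calc ‖E t‖ ^ 2 ≤ √(C * (∑ j, V j t + ‖slide lam (E t)‖ ^ 2)) ^ 2 := by gcongr
      _ = C * (∑ j, V j t + ‖slide lam (E t)‖ ^ 2) := Real.sq_sqrt h0
      _ ≤ C * (d + 1) * (∑ j, V j t + ‖slide lam (E t)‖ ^ 2) := by
          gcongr
          have : (0 : ℝ) ≤ d := d.cast_nonneg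
          nlinarith
  · calc ∑ j, V j t ≤ ∑ j, C * ∑ i ∈ Finset.range l.length, ‖u j i t‖ ^ 2 :=
          Finset.sum_le_sum fun j _ => (hV j t ht).2.2.2.2
      _ = C * ∑ i ∈ Finset.range d, ∑ j, ‖u j i t‖ ^ 2 := by
          rw [← Finset.mul_sum, Finset.sum_comm, hlen]
      _ = C * ∑ i : Fin d, ‖E t i.castSucc‖ ^ 2 := by
          rw [Finset.sum_range]
          simp only [hu_cast, Complex.norm_real, EuclideanSpace.norm_sq_eq]
      _ ≤ C * ∑ _i : Fin d, ‖E t‖ ^ 2 := by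
          gcongr with i
          exact norm_le_pi_norm (E t) i.castSucc
      _ = C * d * ‖E t‖ ^ 2 := by simp; ring
      _ ≤ C * (d + 1) * ‖E t‖ ^ 2 := by gcongr; linarith

end Hurwitz


/-! ### Matrix-vector products and bounds on balls -/

section MatrixVector

variable {a b c : ℕ}

theorem mv_apply (A : Matrix (Fin a) (Fin b) ℝ) (v : Vec b) (i : Fin a) :
    mv A v i = ∑ j, A i j * v j := rfl

/-- Multiplication by a fixed matrix, as a continuous linear map. -/
noncomputable def mvCLM (A : Matrix (Fin a) (Fin b) ℝ) : Vec b →L[ℝ] Vec a :=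
  LinearMap.toContinuousLinearMap (Matrix.toEuclideanLin A)

theorem mvCLM_apply (A : Matrix (Fin a) (Fin b) ℝ) (v : Vec b) : mvCLM A v = mv A v := rfl

theorem mv_sub (A : Matrix (Fin a) (Fin b) ℝ) (v w : Vec b) : mv A (v - w) = mv A v - mv A w :=
  map_sub (mvCLM A) v w

theorem sub_mv (A B : Matrix (Fin a) (Fin b) ℝ) (v : Vec b) :
    mv (A - B) v = mv A v - mv B v := by
  ext i
  simp [mv_apply, sub_mul, Finset.sum_sub_distrib]

theorem mv_mv (A : Matrix (Fin a) (Fin b) ℝ) (B : Matrix (Fin b) (Fin c) ℝ) (v : Vec c) :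
    mv A (mv B v) = mv (A * B) v := by
  simp [mv, Matrix.mulVec_mulVec]

theorem one_mv (v : Vec a) : mv (1 : Matrix (Fin a) (Fin a) ℝ) v = v := by
  simp [mv]

theorem inner_mv_left (A : Matrix (Fin a) (Fin b) ℝ) (v : Vec b) (w : Vec a) :
    inner ℝ (mv A v) w = inner ℝ v (mv Aᵀ w) := by
  simp only [PiLp.inner_apply, mv_apply, RCLike.inner_apply, conj_trivial, Matrix.transpose_apply,
    Finset.mul_sum, Finset.sum_mul]
  rw [Finset.sum_comm]
  exact Finset.sum_congr rfl fun i _ => Finset.sum_congr rfl fun j _ => by ring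

theorem norm_mv_le (A : Matrix (Fin a) (Fin b) ℝ) (v : Vec b) :
    ‖mv A v‖ ≤ (∑ i, ∑ j, |A i j|) * ‖v‖ := by
  have h : mv A v = ∑ i, ∑ j, (A i j * v j) • EuclideanSpace.single i (1 : ℝ) := by
    ext k
    simp [mv_apply, Pi.single_apply]
  rw [h, Finset.sum_mul]
  refine (norm_sum_le _ _).trans (Finset.sum_le_sum fun i _ => ?_)
  rw [Finset.sum_mul]
  refine (norm_sum_le _ _).trans (Finset.sum_le_sum fun j _ => ?_)
  rw [norm_smul, PiLp.norm_single, norm_one, mul_one, norm_mul, Real.norm_eq_abs]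
  gcongr
  exact PiLp.norm_apply_le v j

variable {E : Type*} [NormedAddCommGroup E] [ProperSpace E] {F : E → Matrix (Fin a) (Fin b) ℝ}

theorem exists_norm_mv_le (hF : ∀ i j, LocallyLipschitz fun ξ => F ξ i j) (R : ℝ) :
    ∃ B, 0 ≤ B ∧ ∀ ξ, ‖ξ‖ ≤ R → ∀ v, ‖mv (F ξ) v‖ ≤ B * ‖v‖ := by
  have h : ∀ i j, ∃ B, ∀ ξ ∈ Metric.closedBall (0 : E) R, ‖F ξ i j‖ ≤ B := fun i j =>
    (isCompact_closedBall _ _).exists_bound_of_continuousOn (hF i j).continuous.continuousOn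
  choose B hB using h
  refine ⟨∑ i, ∑ j, |B i j|, by positivity, fun ξ hξ v => (norm_mv_le _ _).trans ?_⟩
  refine mul_le_mul_of_nonneg_right ?_ (norm_nonneg v)
  exact Finset.sum_le_sum fun i _ => Finset.sum_le_sum fun j _ =>
    (hB i j ξ (by simpa using hξ)).trans (le_abs_self _)

theorem exists_norm_sub_mv_le (hF : ∀ i j, LocallyLipschitz fun ξ => F ξ i j) (R : ℝ) :
    ∃ L, 0 ≤ L ∧ ∀ ξ ζ, ‖ξ‖ ≤ R → ‖ζ‖ ≤ R → ∀ v,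
      ‖mv (F ξ - F ζ) v‖ ≤ L * ‖ξ - ζ‖ * ‖v‖ := by
  have h : ∀ i j, ∃ K, LipschitzOnWith K (fun ξ => F ξ i j) (Metric.closedBall (0 : E) R) :=
    fun i j => (hF i j).locallyLipschitzOn.exists_lipschitzOnWith_of_compact
      (isCompact_closedBall _ _)
  choose K hK using h
  refine ⟨∑ i, ∑ j, (K i j : ℝ), by positivity, fun ξ ζ hξ hζ v => (norm_mv_le _ _).trans ?_⟩
  gcongr
  rw [Finset.sum_mul]
  refine Finset.sum_le_sum fun i _ => ?_
  rw [Finset.sum_mul]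
  refine Finset.sum_le_sum fun j _ => ?_
  have := (hK i j).dist_le_mul ξ (by simpa using hξ) ζ (by simpa using hζ)
  rwa [dist_eq_norm, dist_eq_norm] at this

end MatrixVector

/-! ### The saturation function and adaptive damping -/

section Saturation

theorem sat_eq_max_min (v : ℝ) : sat v = max (-1) (min 1 v) := by
  unfold sat
  split_ifs with h1 h2
  · rw [min_eq_left h1, max_eq_right (by norm_num)]
  · rw [min_eq_right (by linarith), max_eq_left h2]
  · rw [min_eq_right (by linarith), max_eq_right (by linarith)]

theorem abs_sat_le_abs (v : ℝ) : |sat v| ≤ |v| := by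
  unfold sat
  split_ifs with h1 h2
  · rw [abs_one]; exact h1.trans (le_abs_self _)
  · rw [abs_neg, abs_one]; linarith [neg_le_abs v]
  · exact le_rfl

theorem mul_sat_nonneg {ε : ℝ} (hε : 0 < ε) (v : ℝ) : 0 ≤ v * sat (v / ε) := by
  unfold sat
  split_ifs with h1 h2
  · rw [le_div_iff₀ hε] at h1; linarith
  · rw [div_le_iff₀ hε] at h2; linarith
  · rw [← mul_div_assoc]
    exact div_nonneg (mul_self_nonneg v) hε.le

variable {p : ℕ} {ε : ℝ}

theorem satVec_apply (y : Vec p) (i : Fin p) : satVec ε y i = sat (y i / ε) := rfl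

theorem inner_satVec_nonneg (hε : 0 < ε) (y : Vec p) : 0 ≤ inner ℝ y (satVec ε y) := by
  rw [PiLp.inner_apply]
  refine Finset.sum_nonneg fun i _ => ?_
  rw [RCLike.inner_apply, conj_trivial, satVec_apply, mul_comm]
  exact mul_sat_nonneg hε _

theorem norm_satVec_le (hε : 0 < ε) (y : Vec p) : ‖satVec ε y‖ ≤ ‖y‖ / ε := by
  have h : ‖satVec ε y‖ ≤ ‖ε⁻¹ • y‖ := by
    rw [EuclideanSpace.norm_eq, EuclideanSpace.norm_eq]
    refine Real.sqrt_le_sqrt (Finset.sum_le_sum fun i _ => ?_)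
    gcongr
    rw [satVec_apply, Real.norm_eq_abs, Real.norm_eq_abs, PiLp.smul_apply, smul_eq_mul,
      inv_mul_eq_div]
    exact abs_sat_le_abs _
  rwa [norm_smul, norm_inv, Real.norm_of_nonneg hε.le, inv_mul_eq_div] at h

theorem satVec_zero : satVec ε (0 : Vec p) = 0 := by
  ext i
  rw [satVec_apply, PiLp.zero_apply, zero_div, sat_eq_max_min]
  norm_num

end Saturation

/-- A scalar variable damped by a monotonically adapted gain is bounded, uniformly in time. -/
theorem le_of_adaptive_damping {w w' y φ φ' : ℝ → ℝ} {τ γ B M ε φ₀ : ℝ} (hγ : 0 < γ)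
    (hB : 0 ≤ B) (hw : ∀ t ∈ Icc 0 τ, HasDerivWithinAt w (w' t) (Icc 0 τ) t)
    (hφ : ∀ t ∈ Icc 0 τ, HasDerivWithinAt φ (φ' t) (Icc 0 τ) t)
    (hφ₀ : ∀ t ∈ Icc 0 τ, φ₀ ≤ φ t) (hy : ∀ t ∈ Icc 0 τ, |y t - w t| ≤ M)
    (hφ' : ∀ t ∈ Icc 0 τ, γ * y t ^ 2 ≤ φ' t)
    (hw' : ∀ t ∈ Icc 0 τ, ε ≤ y t → w' t ≤ B - φ t * y t) :
    ∀ t ∈ Icc 0 τ, w t ≤ max (w 0) (M + max ε (max 1 B)) +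
      (2 + φ₀ ^ 2) * (|φ₀| + B) / γ * Real.pi := by
  -- The correction `a * arctan φ` is bounded, so it costs only a constant, and it contributes at
  -- least `a γ y² / (1 + φ²)` of decay. While `φ₀ ≤ φ ≤ 1` this is at least `(|φ₀| + B) y²`, enough
  -- to beat both `B` and a negative `φ`.
  set a := (2 + φ₀ ^ 2) * (|φ₀| + B) / γ with ha
  have ha0 : 0 ≤ a := by positivity
  have hat : ∀ x : ℝ, a * Real.arctan x ≤ a * (Real.pi / 2) := fun x => by
    gcongr; exact (Real.arctan_lt_pi_div_two x).le
  have hat' : ∀ x : ℝ, a * -(Real.pi / 2) ≤ a * Real.arctan x := fun x => by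
    gcongr; exact (Real.neg_pi_div_two_lt_arctan x).le
  set c := M + max ε (max 1 B) with hc
  set K := max (w 0) c + a * (Real.pi / 2) with hK
  have key := le_of_hasDerivWithinAt_nonpos_above
    (G := fun t => w t - a * Real.arctan (φ t))
    (G' := fun t => w' t - a * (1 / (1 + φ t ^ 2) * φ' t)) (τ := τ) (K := K)
    (fun t ht => (hw t ht).sub ((hφ t ht).arctan.const_mul a))
    (by
      have := hat' (φ 0)
      have := le_max_left (w 0) c
      simp only [K]
      linarith)
    (fun t ht hGt => by
      have h1 := hat' (φ t)
      have h2 : c ≤ w t := by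
        have := le_max_right (w 0) c
        simp only [K] at hGt
        linarith
      have h3 : max ε (max 1 B) ≤ y t := by
        have := (abs_le.1 (hy t ht)).1
        rw [hc] at h2
        linarith
      have hyε : ε ≤ y t := (le_max_left _ _).trans h3
      have hy1 : 1 ≤ y t := (le_max_left _ _).trans ((le_max_right _ _).trans h3)
      have hyB : B ≤ y t := (le_max_right _ _).trans ((le_max_right _ _).trans h3)
      have h4 := hw' t ht hyε
      have h5 : a * (1 / (1 + φ t ^ 2) * (γ * y t ^ 2)) ≤ a * (1 / (1 + φ t ^ 2) * φ' t) := by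
        gcongr; exact hφ' t ht
      -- For `φ ≥ 1` the damping alone suffices, since `φ y ≥ y ≥ B`; for `φ ≤ 1` the arctangent
      -- correction does the work.
      rcases le_total 1 (φ t) with h | h
      · have h6 : 0 ≤ a * (1 / (1 + φ t ^ 2) * (γ * y t ^ 2)) := by positivity
        have h7 : 1 * y t ≤ φ t * y t := by gcongr
        linarith
      · have h6 : φ t ^ 2 ≤ 1 + φ₀ ^ 2 := by
          have := hφ₀ t ht
          rcases le_total 0 (φ t) with h0 | h0
          · nlinarith [sq_nonneg φ₀]
          · nlinarith
        have h7 : (|φ₀| + B) * y t ^ 2 ≤ a * (1 / (1 + φ t ^ 2) * (γ * y t ^ 2)) := by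
          have e : a * (1 / (1 + φ t ^ 2) * (γ * y t ^ 2)) =
              (2 + φ₀ ^ 2) / (1 + φ t ^ 2) * ((|φ₀| + B) * y t ^ 2) := by
            rw [ha]; field_simp
          rw [e]
          refine le_mul_of_one_le_left (by positivity) ?_
          rw [one_le_div (by positivity)]
          linarith
        have h8 : -φ t * y t ≤ |φ₀| * y t := by
          gcongr
          linarith [hφ₀ t ht, neg_le_abs φ₀]
        have h9 : (|φ₀| + B) * y t ≤ (|φ₀| + B) * y t ^ 2 := by
          gcongr
          nlinarith
        have h10 : B * 1 ≤ B * y t := by gcongr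
        linarith)
  intro t ht
  have h1 := key t ht
  have h2 := hat (φ t)
  simp only [K] at h1
  linarith

/-! ### First-order form of the closed loop and uniform bounds -/

section Motion

variable {d p m : ℕ}

/-- The coefficients `λ_1, …, λ_d` for a system of order `d + 1`. -/
def Params.coef (C : Params (d + 1) m) : Fin d → ℝ := C.lam

/-- The feedback `η` as a function of the state, the reference state and the adaptive gains. -/
noncomputable def feedback (F : State (d + 1) p → Matrix (Fin p) (Fin m) ℝ)
    (C : Params (d + 1) m) (ξ ρ : State (d + 1) p) (θh : Vec m) (φ : ℝ) : Vec p :=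
  -(∑ i : Fin d, C.coef i • (ξ - ρ) i.succ) - φ • slide C.coef (ξ - ρ)
    - (‖mv (F ξ - F ρ) θh‖ + C.κ) • satVec C.ε (slide C.coef (ξ - ρ))

/-- A motion of the closed loop in first-order form, with reference state `ρ`, on a time set. -/
structure Motion (F : State (d + 1) p → Matrix (Fin p) (Fin m) ℝ) (θ : Vec m)
    (σ : ℝ → Vec p) (C : Params (d + 1) m) (ρ : ℝ → State (d + 1) p) (s : Set ℝ)
    (X : ℝ → State (d + 1) p) (Z : ℝ → Vec p) (Θ : ℝ → Vec m) (Φ : ℝ → ℝ) : Prop where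
  chain : ∀ t ∈ s, ∀ i : Fin d,
    HasDerivWithinAt (fun τ => X τ i.castSucc) (X t i.succ) s t
  top : ∀ t ∈ s, HasDerivWithinAt (fun τ => X τ (Fin.last d))
    (mv (F (X t)) θ + (σ t + (-(C.k • Z t) + feedback F C (X t) (ρ t) (Θ t) (Φ t)))) s t
  aux : ∀ t ∈ s, HasDerivWithinAt Z (mv (F (X t)) (θ - Θ t) - C.k • Z t) s t
  estimate : ∀ t ∈ s, HasDerivWithinAt Θ (mv C.S (mv (F (X t))ᵀ (Z t))) s t
  gain : ∀ t ∈ s, HasDerivWithinAt Φ (C.γ * ‖slide C.coef (X t - ρ t)‖ ^ 2) s t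

variable {F : State (d + 1) p → Matrix (Fin p) (Fin m) ℝ} {θ : Vec m} {σ : ℝ → Vec p}
  {C : Params (d + 1) m} {ρ : ℝ → State (d + 1) p} {s : Set ℝ} {X : ℝ → State (d + 1) p}
  {Z : ℝ → Vec p} {Θ : ℝ → Vec m} {Φ : ℝ → ℝ}

theorem Motion.mono (h : Motion F θ σ C ρ s X Z Θ Φ) {s' : Set ℝ} (hs : s' ⊆ s) :
    Motion F θ σ C ρ s' X Z Θ Φ where
  chain t ht i := (h.chain t (hs ht) i).mono hs
  top t ht := (h.top t (hs ht)).mono hs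
  aux t ht := (h.aux t (hs ht)).mono hs
  estimate t ht := (h.estimate t (hs ht)).mono hs
  gain t ht := (h.gain t (hs ht)).mono hs

/-- The factorization turns the weight `S⁻¹` into a Euclidean norm: `vᵀ S⁻¹ v = ‖(Bᵀ)⁻¹ v‖²`. -/
theorem exists_eq_transpose_mul_self_of_posDef {S : Matrix (Fin m) (Fin m) ℝ} (hS : S.PosDef) :
    ∃ B : Matrix (Fin m) (Fin m) ℝ, S = Bᵀ * B ∧ (Bᵀ)⁻¹ * Bᵀ = 1 ∧ Bᵀ * (Bᵀ)⁻¹ = 1 := by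
  open scoped MatrixOrder in
  obtain ⟨B, hB⟩ := CStarAlgebra.nonneg_iff_eq_star_mul_self.1 hS.posSemidef.nonneg
  have hB' : S = Bᵀ * B := by
    rw [hB, Matrix.star_eq_conjTranspose, Matrix.conjTranspose_eq_transpose_of_trivial]
  have hdet : IsUnit (Bᵀ).det := by
    have := (Matrix.isUnit_iff_isUnit_det _).1 hS.isUnit
    rw [hB', Matrix.det_mul] at this
    exact isUnit_of_mul_isUnit_left this
  exact ⟨B, hB', Matrix.nonsing_inv_mul _ hdet, Matrix.mul_nonsing_inv _ hdet⟩

/-- The energy of the auxiliary error and the estimation error is dissipated. -/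
theorem exists_energy (F : State (d + 1) p → Matrix (Fin p) (Fin m) ℝ) (θ : Vec m)
    (σ : ℝ → Vec p) (ρ : ℝ → State (d + 1) p) (hC : C.S.PosDef) :
    ∃ D, 0 ≤ D ∧ ∀ s X Z Θ Φ, Motion F θ σ C ρ s X Z Θ Φ → ∃ H : ℝ → ℝ, ∀ t ∈ s,
      HasDerivWithinAt H (-2 * C.k * ‖Z t‖ ^ 2) s t ∧ ‖Z t‖ ^ 2 ≤ H t ∧
      ‖Θ t - θ‖ ^ 2 ≤ D * H t ∧ H t ≤ ‖Z t‖ ^ 2 + D * ‖Θ t - θ‖ ^ 2 := by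
  obtain ⟨B, hB, hinv, hinv'⟩ := exists_eq_transpose_mul_self_of_posDef hC
  set N := ∑ i, ∑ j, |Bᵀ i j|
  set N' := ∑ i, ∑ j, |(Bᵀ)⁻¹ i j|
  refine ⟨N ^ 2 + N' ^ 2, by positivity, fun s X Z Θ Φ h => ?_⟩
  set q : ℝ → Vec m := fun t => mv (Bᵀ)⁻¹ (Θ t - θ) with hq
  have hBq : ∀ t, mv Bᵀ (q t) = Θ t - θ := fun t => by rw [hq, mv_mv, hinv', one_mv]
  refine ⟨fun t => ‖Z t‖ ^ 2 + ‖q t‖ ^ 2, fun t ht => ⟨?_, ?_, ?_, ?_⟩⟩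
  · have hq' : HasDerivWithinAt q (mv (B * (F (X t))ᵀ) (Z t)) s t := by
      have h1 := (mvCLM (Bᵀ)⁻¹).hasFDerivAt.comp_hasDerivWithinAt t
        ((h.estimate t ht).sub_const θ)
      have e : mvCLM (Bᵀ)⁻¹ (mv C.S (mv (F (X t))ᵀ (Z t))) = mv (B * (F (X t))ᵀ) (Z t) := by
        rw [mvCLM_apply, mv_mv, mv_mv, hB, ← Matrix.mul_assoc, hinv,
          Matrix.one_mul]
      rw [← e]
      exact h1
    have h2 := (h.aux t ht).norm_sq.add hq'.norm_sq
    refine h2.congr_deriv ?_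
    have e1 : mv (F (X t)) (θ - Θ t) = -mv (F (X t) * Bᵀ) (q t) := by
      rw [← mv_mv, hBq, ← neg_sub (Θ t) θ]
      exact map_neg (mvCLM (F (X t))) _
    -- The estimation law is the adjoint of the way the estimation error drives `Z`, so the two
    -- cross terms of the energy cancel.
    have e2 : inner ℝ (q t) (mv (B * (F (X t))ᵀ) (Z t)) =
        inner ℝ (Z t) (mv (F (X t) * Bᵀ) (q t)) := by
      rw [real_inner_comm, real_inner_comm (mv (F (X t) * Bᵀ) (q t)), inner_mv_left,
        real_inner_comm, Matrix.transpose_mul, Matrix.transpose_transpose]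
    rw [e1, e2, inner_sub_right, inner_neg_right, inner_smul_right, real_inner_self_eq_norm_sq]
    ring
  · have : 0 ≤ ‖q t‖ ^ 2 := by positivity
    linarith
  · have h1 : ‖Θ t - θ‖ ≤ N * ‖q t‖ := by rw [← hBq]; exact norm_mv_le _ _
    calc ‖Θ t - θ‖ ^ 2 ≤ (N * ‖q t‖) ^ 2 := by gcongr
      _ = N ^ 2 * ‖q t‖ ^ 2 := by ring
      _ ≤ (N ^ 2 + N' ^ 2) * (‖Z t‖ ^ 2 + ‖q t‖ ^ 2) := by
        gcongr
        · linarith [sq_nonneg N']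
        · linarith [sq_nonneg ‖Z t‖]
  · have h1 : ‖q t‖ ≤ N' * ‖Θ t - θ‖ := norm_mv_le _ _
    calc ‖Z t‖ ^ 2 + ‖q t‖ ^ 2 ≤ ‖Z t‖ ^ 2 + (N' * ‖Θ t - θ‖) ^ 2 := by gcongr
      _ = ‖Z t‖ ^ 2 + N' ^ 2 * ‖Θ t - θ‖ ^ 2 := by ring
      _ ≤ ‖Z t‖ ^ 2 + (N ^ 2 + N' ^ 2) * ‖Θ t - θ‖ ^ 2 := by
        gcongr
        linarith [sq_nonneg N]

/-- The sliding variable, shifted by the auxiliary error, evolves independently of `θ`. -/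
theorem Motion.hasDerivWithinAt_shifted (h : Motion F θ σ C ρ s X Z Θ Φ)
    (hρ : ∀ t ∈ s, ∀ i : Fin d, HasDerivWithinAt (fun τ => ρ τ i.castSucc) (ρ t i.succ) s t)
    {t : ℝ} (ht : t ∈ s) :
    HasDerivWithinAt (fun t => slide C.coef (X t - ρ t) + ρ t (Fin.last d) - Z t)
      (σ t + mv (F (ρ t)) (Θ t) + mv (F (X t) - F (ρ t)) (Θ t)
        - Φ t • slide C.coef (X t - ρ t)
        - (‖mv (F (X t) - F (ρ t)) (Θ t)‖ + C.κ) • satVec C.ε (slide C.coef (X t - ρ t))) s t := by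
  have h1 : HasDerivWithinAt (fun t => ∑ i : Fin d, C.coef i • (X t - ρ t) i.castSucc)
      (∑ i : Fin d, C.coef i • (X t - ρ t) i.succ) s t :=
    HasDerivWithinAt.fun_sum fun i _ => ((h.chain t ht i).sub (hρ t ht i)).const_smul (C.coef i)
  have h2 := ((h.top t ht).add h1).sub (h.aux t ht)
  -- Adding `ρ_d` leaves `X_d` undiminished, so `x^{r(n)}`, which need not be bounded, does not
  -- enter. Subtracting `Z` removes `F(X)θ` and `-kZ`, and the derivative terms of `η` cancel
  -- against the lower blocks.
  have e : (fun t => slide C.coef (X t - ρ t) + ρ t (Fin.last d) - Z t) =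
      fun t => X t (Fin.last d) + ∑ i : Fin d, C.coef i • (X t - ρ t) i.castSucc - Z t := by
    funext t
    simp only [slide, Pi.sub_apply]
    abel
  rw [e]
  refine h2.congr_deriv ?_
  rw [mv_sub, sub_mv, feedback, sub_mv]
  abel

/-- The motions with given initial values obey bounds which do not depend on the time interval. -/
theorem exists_bound_of_motion (hF : ∀ i j, LocallyLipschitz fun ξ => F ξ i j)
    (hC : C.Admissible) (hσ : BoundedSignal σ) (hρb : BoundedSignal ρ)
    (hρ : ∀ t ∈ Ici (0 : ℝ), ∀ i : Fin d,
      HasDerivWithinAt (fun τ => ρ τ i.castSucc) (ρ t i.succ) (Ici 0) t)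
    (X₀ : State (d + 1) p) (Z₀ : Vec p) (Θ₀ : Vec m) (Φ₀ : ℝ) :
    ∃ R, 0 ≤ R ∧ ∀ τ X Z Θ Φ, Motion F θ σ C ρ (Icc 0 τ) X Z Θ Φ →
      X 0 = X₀ → Z 0 = Z₀ → Θ 0 = Θ₀ → Φ 0 = Φ₀ →
      ∀ t ∈ Icc 0 τ, ‖X t‖ ≤ R ∧ ‖Z t‖ ≤ R ∧ ‖Θ t‖ ≤ R ∧ |Φ t| ≤ |Φ₀| + R * t := by
  obtain ⟨Mσ, hMσ⟩ := hσ
  obtain ⟨Mρ, hMρ⟩ := hρb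
  have hMσ0 : 0 ≤ Mσ := (norm_nonneg _).trans (hMσ 0 le_rfl)
  have hMρ0 : 0 ≤ Mρ := (norm_nonneg _).trans (hMρ 0 le_rfl)
  obtain ⟨D, hD, hE⟩ := exists_energy F θ σ ρ hC.S_posDef
  obtain ⟨B, hB, hFB⟩ := exists_norm_mv_le hF Mρ
  obtain ⟨a, ha, K, hK, hL⟩ := exists_lyapunov_of_hurwitz p C.coef hC.hurwitz
  set h₀ := ‖Z₀‖ ^ 2 + D * ‖Θ₀ - θ‖ ^ 2
  have hh₀ : 0 ≤ h₀ := by positivity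
  set Mz := √h₀
  set Mθ := √(D * h₀) + ‖θ‖
  set M := Mρ + Mz
  set b := Mσ + B * Mθ
  have hb : 0 ≤ b := by positivity
  set w₀ := ‖slide C.coef (X₀ - ρ 0) + ρ 0 (Fin.last d) - Z₀‖
  -- The bound of `le_of_adaptive_damping`, with `w₀` in place of the initial value, so that it
  -- serves every coordinate of `w` and of `-w`.
  set W := max w₀ (M + max C.ε (max 1 b)) + (2 + Φ₀ ^ 2) * (|Φ₀| + b) / C.γ * Real.pi with hW
  set Y := √(p * (W + M) ^ 2)
  -- Once `‖y‖ ≤ Y`, the Lyapunov function cannot increase above `K Y² / a`; the first entry covers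
  -- its initial value.
  set v := max (K * ‖X₀ - ρ 0‖ ^ 2) (K * Y ^ 2 / a)
  have hv : 0 ≤ v := by positivity
  have hγ := hC.γ_pos
  refine ⟨√(K * (v + Y ^ 2)) + Mρ + Mz + Mθ + C.γ * Y ^ 2, by positivity, ?_⟩
  intro τ X Z Θ Φ hm hX₀ hZ₀ hΘ₀ hΦ₀ t ht
  have hτ : 0 ≤ τ := ht.1.trans ht.2
  have h0τ : (0 : ℝ) ∈ Icc 0 τ := left_mem_Icc.2 hτ
  have hρ' : ∀ t ∈ Icc 0 τ, ∀ i : Fin d,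
      HasDerivWithinAt (fun τ => ρ τ i.castSucc) (ρ t i.succ) (Icc 0 τ) t := fun t ht i =>
    (hρ t ht.1 i).mono Icc_subset_Ici_self
  obtain ⟨H, hH⟩ := hE _ X Z Θ Φ hm
  have hHb : ∀ t ∈ Icc 0 τ, H t ≤ h₀ := by
    refine le_of_hasDerivWithinAt_nonpos_above (fun t ht => (hH t ht).1) ?_ fun t _ _ => ?_
    · simpa only [hZ₀, hΘ₀] using (hH 0 h0τ).2.2.2
    · have := mul_nonneg hC.k_pos.le (sq_nonneg ‖Z t‖)
      linarith
  have hZb : ∀ t ∈ Icc 0 τ, ‖Z t‖ ≤ Mz := fun t ht =>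
    Real.le_sqrt_of_sq_le ((hH t ht).2.1.trans (hHb t ht))
  have hΘb : ∀ t ∈ Icc 0 τ, ‖Θ t‖ ≤ Mθ := fun t ht => by
    have h1 : ‖Θ t - θ‖ ≤ √(D * h₀) := Real.le_sqrt_of_sq_le
      ((hH t ht).2.2.1.trans (by gcongr; exact hHb t ht))
    have h2 := norm_le_norm_add_norm_sub' (Θ t) θ
    simp only [Mθ]
    linarith
  have hsub : ∀ {t}, t ∈ Icc 0 τ → Icc 0 t ⊆ Icc 0 τ := fun ht => Icc_subset_Icc_right ht.2
  have hΦb : ∀ t ∈ Icc 0 τ, Φ₀ ≤ Φ t := fun t ht => by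
    have := sub_le_mul_sub_of_hasDerivWithinAt_le (c := 0) ht.1
      (fun u hu => ((hm.gain u (hsub ht hu)).mono (hsub ht)).neg) fun u hu => by
        have : 0 ≤ C.γ * ‖slide C.coef (X u - ρ u)‖ ^ 2 := by positivity
        linarith
    simp only [Pi.neg_apply, hΦ₀] at this
    linarith
  set y : ℝ → Vec p := fun t => slide C.coef (X t - ρ t) with hy
  set w : ℝ → Vec p := fun t => y t + ρ t (Fin.last d) - Z t with hw
  have hyw : ∀ t ∈ Icc 0 τ, ∀ j, |y t j - w t j| ≤ M := fun t ht j => by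
    have e : y t j - w t j = (Z t - ρ t (Fin.last d)) j := by
      simp only [hw, PiLp.add_apply, PiLp.sub_apply]; ring
    rw [e, ← Real.norm_eq_abs]
    refine (PiLp.norm_apply_le _ j).trans ((norm_sub_le _ _).trans ?_)
    have h1 := hZb t ht
    have h2 := (norm_le_pi_norm (ρ t) (Fin.last d)).trans (hMρ t ht.1)
    simp only [M]
    linarith
  have hbb : ∀ t ∈ Icc 0 τ, ‖σ t + mv (F (ρ t)) (Θ t)‖ ≤ b := fun t ht => by
    refine (norm_add_le _ _).trans ?_
    have h1 := hMσ t ht.1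
    have h2 := hFB (ρ t) (hMρ t ht.1) (Θ t)
    have h3 : B * ‖Θ t‖ ≤ B * Mθ := by gcongr; exact hΘb t ht
    simp only [b]
    linarith
  set Δ : ℝ → Vec p := fun t => mv (F (X t) - F (ρ t)) (Θ t)
  set w' : ℝ → Vec p := fun t => σ t + mv (F (ρ t)) (Θ t) + Δ t - Φ t • y t -
    (‖Δ t‖ + C.κ) • satVec C.ε (y t) with hw'
  have hwd : ∀ j, ∀ t ∈ Icc 0 τ, HasDerivWithinAt (fun t => w t j) (w' t j) (Icc 0 τ) t :=
    fun j t ht => hasDerivWithinAt_coord (hm.hasDerivWithinAt_shifted hρ' ht) j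
  have hwj : ∀ j t, w' t j = (σ t + mv (F (ρ t)) (Θ t)) j + Δ t j - Φ t * y t j -
      (‖Δ t‖ + C.κ) * sat (y t j / C.ε) := fun j t => rfl
  have hγy : ∀ t j, C.γ * y t j ^ 2 ≤ C.γ * ‖y t‖ ^ 2 := fun t j => by
    have : ‖y t j‖ ^ 2 ≤ ‖y t‖ ^ 2 := by gcongr; exact PiLp.norm_apply_le _ j
    rw [Real.norm_eq_abs, sq_abs] at this
    gcongr
  have hε := hC.ε_pos
  have hκ := hC.κ_pos
  have hw₀ : ∀ j, |w 0 j| ≤ w₀ := fun j => by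
    have := PiLp.norm_apply_le (w 0) j
    simp only [hw, hy, hX₀, hZ₀] at this
    simp only [hw, hy, hX₀, hZ₀]
    exact this
  have hcoord : ∀ (u : Vec p) j, |u j| ≤ ‖u‖ := fun u j => PiLp.norm_apply_le u j
  have hup : ∀ j, ∀ t ∈ Icc 0 τ, w t j ≤ W := fun j t ht => by
    refine (le_of_adaptive_damping (y := fun t => y t j) (M := M) (ε := C.ε) hγ hb (hwd j)
      hm.gain hΦb (fun t ht => hyw t ht j) (fun t _ => hγy t j) ?_ t ht).trans ?_
    -- Saturation is complete here, so the gain `‖Δ‖ + κ` acts with full strength and absorbs the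
    -- coordinate `Δ_j`, however large.
    · intro t ht hεy
      have hs : sat (y t j / C.ε) = 1 := if_pos ((one_le_div hε).2 hεy)
      rw [hwj, hs]
      have h1 := (abs_le.1 ((hcoord _ j).trans (hbb t ht))).2
      have h2 := (abs_le.1 (hcoord (Δ t) j)).2
      linarith
    · rw [hW]
      gcongr
      exact (le_abs_self _).trans (hw₀ j)
  have hlow : ∀ j, ∀ t ∈ Icc 0 τ, -w t j ≤ W := fun j t ht => by
    refine (le_of_adaptive_damping (y := fun t => -y t j) (w := fun t => -w t j)
      (w' := fun t => -w' t j) (M := M) (ε := C.ε) hγ hb (fun t ht => (hwd j t ht).neg)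
      hm.gain hΦb (fun t ht => ?_) (fun t _ => ?_) ?_ t ht).trans ?_
    · rw [← abs_neg]
      convert hyw t ht j using 2
      ring
    · rw [neg_sq]; exact hγy t j
    · intro t ht hεy
      have hs : sat (y t j / C.ε) = -1 := by
        have h1 : y t j / C.ε ≤ -1 := by rw [div_le_iff₀ hε]; linarith
        rw [sat, if_neg (by linarith), if_pos h1]
      rw [hwj, hs]
      have h1 := (abs_le.1 ((hcoord _ j).trans (hbb t ht))).1
      have h2 := (abs_le.1 (hcoord (Δ t) j)).1
      linarith
    · rw [hW]
      gcongr
      exact (neg_le_abs _).trans (hw₀ j)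
  have hyb : ∀ t ∈ Icc 0 τ, ‖y t‖ ≤ Y := fun t ht => by
    refine Real.le_sqrt_of_sq_le ?_
    rw [EuclideanSpace.norm_sq_eq]
    calc ∑ j, ‖y t j‖ ^ 2 ≤ ∑ _j : Fin p, (W + M) ^ 2 := by
          refine Finset.sum_le_sum fun j _ => ?_
          gcongr
          rw [Real.norm_eq_abs, abs_le]
          have h1 := abs_le.1 (hyw t ht j)
          have h2 := hup j t ht
          have h3 := hlow j t ht
          constructor <;> linarith
      _ = p * (W + M) ^ 2 := by simp
  obtain ⟨V, V', hV⟩ := hL (Icc 0 τ) (fun t => X t - ρ t) fun t ht i =>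
    (hm.chain t ht i).sub (hρ' t ht i)
  have hVb : ∀ t ∈ Icc 0 τ, V t ≤ v := by
    refine le_of_hasDerivWithinAt_nonpos_above (fun t ht => (hV t ht).1) ?_ fun t ht hvt => ?_
    · have := (hV 0 h0τ).2.2.2.2
      simp only [hX₀] at this
      exact this.trans (le_max_left _ _)
    · have h1 : K * Y ^ 2 / a < V t := (le_max_right _ _).trans_lt hvt
      rw [div_lt_iff₀ ha] at h1
      have h2 := (hV t ht).2.2.1
      have h3 : K * ‖slide C.coef (X t - ρ t)‖ ^ 2 ≤ K * Y ^ 2 := by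
        gcongr; exact hyb t ht
      linarith
  have hEb : ‖X t - ρ t‖ ≤ √(K * (v + Y ^ 2)) := by
    refine Real.le_sqrt_of_sq_le ((hV t ht).2.2.2.1.trans ?_)
    gcongr
    · exact hVb t ht
    · exact hyb t ht
  have hXb := norm_le_norm_add_norm_sub' (X t) (ρ t)
  have hs0 : 0 ≤ √(K * (v + Y ^ 2)) := Real.sqrt_nonneg _
  have hMz0 : 0 ≤ Mz := Real.sqrt_nonneg _
  have hMθ0 : 0 ≤ Mθ := by positivity
  have hY0 : 0 ≤ C.γ * Y ^ 2 := by positivity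
  refine ⟨?_, ?_, ?_, ?_⟩
  · linarith [hMρ t ht.1]
  · linarith [hZb t ht]
  · linarith [hΘb t ht]
  -- For a general reference `y` need not decay, so the estimate of `Φ` is only linear in time; this
  -- is enough to exclude blow-up.
  · have h1 := sub_le_mul_sub_of_hasDerivWithinAt_le (c := C.γ * Y ^ 2) ht.1
      (fun u hu => (hm.gain u (hsub ht hu)).mono (hsub ht)) fun u hu => by
        gcongr; exact hyb u (hsub ht (Ioo_subset_Icc_self hu))
    have h2 := hΦb t ht
    have h3 : C.γ * Y ^ 2 * t ≤ (√(K * (v + Y ^ 2)) + Mρ + Mz + Mθ + C.γ * Y ^ 2) * t := by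
      gcongr
      · exact ht.1
      · linarith
    have h4 : 0 ≤ C.γ * Y ^ 2 * t := mul_nonneg hY0 ht.1
    rw [hΦ₀, sub_zero] at h1
    rw [abs_le]
    constructor <;> linarith [le_abs_self Φ₀, neg_abs_le Φ₀]

end Motion


/-! ### Local Lipschitz continuity of the feedback -/

section LocallyLipschitz

variable {α : Type*} [PseudoEMetricSpace α] {V W : Type*} [NormedAddCommGroup V]
  [NormedAddCommGroup W]

theorem locallyLipschitz_smul [NormedSpace ℝ V] {f : α → ℝ} {g : α → V} (hf : LocallyLipschitz f)
    (hg : LocallyLipschitz g) : LocallyLipschitz fun a => f a • g a :=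
  (contDiff_smul (𝕜 := ℝ) (𝕜' := ℝ) (F := V)).locallyLipschitz.comp (hf.prodMk hg)

theorem locallyLipschitz_clm [NormedSpace ℝ V] [NormedSpace ℝ W] (L : V →L[ℝ] W) {f : α → V} (hf : LocallyLipschitz f) :
    LocallyLipschitz fun a => L (f a) :=
  L.lipschitz.locallyLipschitz.comp hf

theorem locallyLipschitz_sum {ι : Type*} (s : Finset ι) {f : ι → α → V}
    (hf : ∀ i, LocallyLipschitz (f i)) : LocallyLipschitz fun a => ∑ i ∈ s, f i a := by
  classical
  induction s using Finset.induction_on with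
  | empty => simpa using LocallyLipschitz.const (0 : V)
  | insert i s hi ih =>
    simp only [Finset.sum_insert hi]
    exact (hf i).add ih

theorem locallyLipschitz_norm {f : α → V} (hf : LocallyLipschitz f) :
    LocallyLipschitz fun a => ‖f a‖ :=
  lipschitzWith_one_norm.locallyLipschitz.comp hf

theorem locallyLipschitz_vec {a : ℕ} {f : α → Vec a}
    (hf : ∀ i, LocallyLipschitz fun x => f x i) : LocallyLipschitz f := by
  have h : f = fun x => ∑ i, f x i • EuclideanSpace.single i (1 : ℝ) := by
    funext x
    ext k
    simp [Pi.single_apply]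
  rw [h]
  exact locallyLipschitz_sum _ fun i => locallyLipschitz_smul (hf i) (LocallyLipschitz.const _)

theorem locallyLipschitz_coord {a : ℕ} {f : α → Vec a} (hf : LocallyLipschitz f) (i : Fin a) :
    LocallyLipschitz fun x => f x i :=
  locallyLipschitz_clm (EuclideanSpace.proj (𝕜 := ℝ) i) hf

theorem locallyLipschitz_mv {a b : ℕ} {A : α → Matrix (Fin a) (Fin b) ℝ} {v : α → Vec b}
    (hA : ∀ i j, LocallyLipschitz fun x => A x i j) (hv : LocallyLipschitz v) :
    LocallyLipschitz fun x => mv (A x) (v x) :=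
  locallyLipschitz_vec fun i => locallyLipschitz_sum Finset.univ fun j =>
    locallyLipschitz_smul (hA i j) (locallyLipschitz_coord hv j)

theorem locallyLipschitz_satVec {p : ℕ} (ε : ℝ) {y : α → Vec p} (hy : LocallyLipschitz y) :
    LocallyLipschitz fun x => satVec ε (y x) := by
  refine locallyLipschitz_vec fun i => ?_
  simp only [satVec_apply, sat_eq_max_min, div_eq_inv_mul]
  exact ((locallyLipschitz_smul (LocallyLipschitz.const ε⁻¹)
    (locallyLipschitz_coord hy i)).const_min 1).const_max (-1)

variable {d p m : ℕ}

theorem locallyLipschitz_block {k : ℕ} {f : α → State k p} (hf : LocallyLipschitz f)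
    (i : Fin k) : LocallyLipschitz fun a => f a i :=
  locallyLipschitz_clm (ContinuousLinearMap.proj (R := ℝ) (φ := fun _ : Fin k => Vec p) i) hf

theorem locallyLipschitz_slide (lam : Fin d → ℝ) {E : α → State (d + 1) p}
    (hE : LocallyLipschitz E) : LocallyLipschitz fun a => slide lam (E a) :=
  (locallyLipschitz_block hE _).add (locallyLipschitz_sum _ fun i =>
    locallyLipschitz_smul (LocallyLipschitz.const (lam i)) (locallyLipschitz_block hE _))

variable {F : State (d + 1) p → Matrix (Fin p) (Fin m) ℝ} {C : Params (d + 1) m}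

theorem locallyLipschitz_feedback (hF : ∀ i j, LocallyLipschitz fun ξ => F ξ i j)
    {X ρ : α → State (d + 1) p} {Θ : α → Vec m} {Φ : α → ℝ} (hX : LocallyLipschitz X)
    (hρ : LocallyLipschitz ρ) (hΘ : LocallyLipschitz Θ) (hΦ : LocallyLipschitz Φ) :
    LocallyLipschitz fun a => feedback F C (X a) (ρ a) (Θ a) (Φ a) := by
  have hE : LocallyLipschitz fun a => X a - ρ a := hX.sub hρ
  have hy := locallyLipschitz_slide C.coef hE
  refine (LocallyLipschitz.sub (LocallyLipschitz.neg (locallyLipschitz_sum _ fun i =>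
    locallyLipschitz_smul (LocallyLipschitz.const (C.coef i)) (locallyLipschitz_block hE _)))
    (locallyLipschitz_smul hΦ hy)).sub (locallyLipschitz_smul
      ((locallyLipschitz_norm (locallyLipschitz_mv (fun i j => ?_) hΘ)).add
        (LocallyLipschitz.const C.κ)) (locallyLipschitz_satVec _ hy))
  exact ((hF i j).comp hX).sub ((hF i j).comp hρ)

end LocallyLipschitz


/-! ### The closed-loop vector field and existence of motions -/

section Existence

variable {d p m : ℕ}

/-- The blocks `1, …, d` of a stacked vector, followed by a new last block. -/
def shiftAppend (ξ : State (d + 1) p) (v : Vec p) : State (d + 1) p := fun i =>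
  if h : (i : ℕ) < d then ξ ⟨i + 1, Nat.succ_lt_succ h⟩ else v

theorem shiftAppend_castSucc (ξ : State (d + 1) p) (v : Vec p) (i : Fin d) :
    shiftAppend ξ v i.castSucc = ξ i.succ := dif_pos i.2

theorem shiftAppend_last (ξ : State (d + 1) p) (v : Vec p) :
    shiftAppend ξ v (Fin.last d) = v := dif_neg (lt_irrefl _)

theorem locallyLipschitz_shiftAppend {α : Type*} [PseudoEMetricSpace α]
    {f : α → State (d + 1) p} {g : α → Vec p} (hf : LocallyLipschitz f)
    (hg : LocallyLipschitz g) : LocallyLipschitz fun a => shiftAppend (f a) (g a) := by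
  have h : ContDiff ℝ 1 fun x : State (d + 1) p × Vec p => shiftAppend x.1 x.2 := by
    refine contDiff_pi.2 fun i => ?_
    by_cases hi : (i : ℕ) < d
    · simp only [shiftAppend, dif_pos hi]
      exact (contDiff_apply ℝ (Vec p) _).comp contDiff_fst
    · simp only [shiftAppend, dif_neg hi]
      exact contDiff_snd
  have h' := h.locallyLipschitz.comp (hf.prodMk hg)
  exact h'

/-- The phase space of the closed loop. -/
abbrev Phase (d p m : ℕ) : Type := State (d + 1) p × Vec p × Vec m × ℝ

/-- The vector field of the closed loop, as a function of the excitation, the reference state and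
the phase point. -/
noncomputable def closedLoopField (F : State (d + 1) p → Matrix (Fin p) (Fin m) ℝ) (θ : Vec m)
    (C : Params (d + 1) m) (q : Vec p × State (d + 1) p × Phase d p m) : Phase d p m :=
  (shiftAppend q.2.2.1
      (mv (F q.2.2.1) θ + (q.1 + (-(C.k • q.2.2.2.1) +
        feedback F C q.2.2.1 q.2.1 q.2.2.2.2.1 q.2.2.2.2.2))),
    mv (F q.2.2.1) (θ - q.2.2.2.2.1) - C.k • q.2.2.2.1,
    mv C.S (mv (F q.2.2.1)ᵀ q.2.2.2.1),
    C.γ * ‖slide C.coef (q.2.2.1 - q.2.1)‖ ^ 2)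

variable {F : State (d + 1) p → Matrix (Fin p) (Fin m) ℝ} {θ : Vec m} {σ : ℝ → Vec p}
  {C : Params (d + 1) m} {ρ : ℝ → State (d + 1) p}

theorem locallyLipschitz_closedLoopField (hF : ∀ i j, LocallyLipschitz fun ξ => F ξ i j) :
    LocallyLipschitz (closedLoopField F θ C) := by
  have hf : ∀ {A B : Type} [PseudoEMetricSpace A] [PseudoEMetricSpace B],
    LocallyLipschitz (Prod.fst : A × B → A) := LipschitzWith.prod_fst.locallyLipschitz
  have hs : ∀ {A B : Type} [PseudoEMetricSpace A] [PseudoEMetricSpace B],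
    LocallyLipschitz (Prod.snd : A × B → B) := LipschitzWith.prod_snd.locallyLipschitz
  have hσ : LocallyLipschitz fun q : Vec p × State (d + 1) p × Phase d p m => q.1 := hf
  have hρ : LocallyLipschitz fun q : Vec p × State (d + 1) p × Phase d p m => q.2.1 :=
    hf.comp hs
  have hu : LocallyLipschitz fun q : Vec p × State (d + 1) p × Phase d p m => q.2.2 :=
    hs.comp hs
  have hX : LocallyLipschitz fun q : Vec p × State (d + 1) p × Phase d p m => q.2.2.1 :=
    hf.comp hu
  have hZ : LocallyLipschitz fun q : Vec p × State (d + 1) p × Phase d p m => q.2.2.2.1 :=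
    hf.comp (hs.comp hu)
  have hΘ : LocallyLipschitz fun q : Vec p × State (d + 1) p × Phase d p m => q.2.2.2.2.1 :=
    hf.comp (hs.comp (hs.comp hu))
  have hΦ : LocallyLipschitz fun q : Vec p × State (d + 1) p × Phase d p m => q.2.2.2.2.2 :=
    hs.comp (hs.comp (hs.comp hu))
  have hFX : ∀ i j, LocallyLipschitz
      fun q : Vec p × State (d + 1) p × Phase d p m => F q.2.2.1 i j := fun i j => (hF i j).comp hX
  have hc : ∀ c : ℝ, LocallyLipschitz fun _ : Vec p × State (d + 1) p × Phase d p m => c :=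
    fun c => LocallyLipschitz.const c
  have hkZ := locallyLipschitz_smul (hc C.k) hZ
  have htop := (locallyLipschitz_mv hFX (LocallyLipschitz.const θ)).add
    (hσ.add ((LocallyLipschitz.neg hkZ).add
      (locallyLipschitz_feedback (C := C) hF hX hρ hΘ hΦ)))
  have haux := (locallyLipschitz_mv hFX ((LocallyLipschitz.const θ).sub hΘ)).sub hkZ
  have hest := locallyLipschitz_mv (A := fun _ => C.S) (fun i j => LocallyLipschitz.const _)
    (locallyLipschitz_mv (A := fun q : Vec p × State (d + 1) p × Phase d p m => (F q.2.2.1)ᵀ)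
      (fun i j => hFX j i) hZ)
  have hn := locallyLipschitz_norm (locallyLipschitz_slide C.coef (hX.sub hρ))
  have hgain := locallyLipschitz_smul (hc C.γ) (locallyLipschitz_smul hn hn)
  have h := (locallyLipschitz_shiftAppend hX htop).prodMk (haux.prodMk (hest.prodMk hgain))
  have e : closedLoopField F θ C = fun q => (shiftAppend q.2.2.1
      (mv (F q.2.2.1) θ + (q.1 + (-(C.k • q.2.2.2.1) +
        feedback F C q.2.2.1 q.2.1 q.2.2.2.2.1 q.2.2.2.2.2))),
      mv (F q.2.2.1) (θ - q.2.2.2.2.1) - C.k • q.2.2.2.1, mv C.S (mv (F q.2.2.1)ᵀ q.2.2.2.1),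
      C.γ • (‖slide C.coef (q.2.2.1 - q.2.1)‖ • ‖slide C.coef (q.2.2.1 - q.2.1)‖)) := by
    funext q
    simp only [closedLoopField, pow_two, smul_eq_mul]
  rw [e]
  exact h

theorem motion_of_hasDerivWithinAt {s : Set ℝ} {u : ℝ → Phase d p m}
    (hu : ∀ t ∈ s, HasDerivWithinAt u (closedLoopField F θ C (σ t, ρ t, u t)) s t) :
    Motion F θ σ C ρ s (fun t => (u t).1) (fun t => (u t).2.1) (fun t => (u t).2.2.1)
      (fun t => (u t).2.2.2) := by
  have h1 := fun t ht => (ContinuousLinearMap.fst ℝ (State (d + 1) p)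
    (Vec p × Vec m × ℝ)).hasFDerivAt.comp_hasDerivWithinAt t (hu t ht)
  have h2 := fun t ht => (ContinuousLinearMap.snd ℝ (State (d + 1) p)
    (Vec p × Vec m × ℝ)).hasFDerivAt.comp_hasDerivWithinAt t (hu t ht)
  have h3 := fun t ht => (ContinuousLinearMap.fst ℝ (Vec p) (Vec m × ℝ)).hasFDerivAt
    |>.comp_hasDerivWithinAt t (h2 t ht)
  have h4 := fun t ht => (ContinuousLinearMap.snd ℝ (Vec p) (Vec m × ℝ)).hasFDerivAt
    |>.comp_hasDerivWithinAt t (h2 t ht)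
  have h5 := fun t ht => (ContinuousLinearMap.fst ℝ (Vec m) ℝ).hasFDerivAt
    |>.comp_hasDerivWithinAt t (h4 t ht)
  have h6 := fun t ht => (ContinuousLinearMap.snd ℝ (Vec m) ℝ).hasFDerivAt
    |>.comp_hasDerivWithinAt t (h4 t ht)
  refine ⟨fun t ht i => ?_, fun t ht => ?_, h3, h5, h6⟩
  · refine (hasDerivWithinAt_pi.1 (h1 t ht) i.castSucc).congr_deriv ?_
    exact shiftAppend_castSucc _ _ i
  · refine (hasDerivWithinAt_pi.1 (h1 t ht) (Fin.last d)).congr_deriv ?_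
    exact shiftAppend_last _ _

theorem exists_motion (hF : ∀ i j, LocallyLipschitz fun ξ => F ξ i j) (hC : C.Admissible)
    (hσ : ContinuousOn σ (Ici 0)) (hσb : BoundedSignal σ) (hρb : BoundedSignal ρ)
    (hρc : ContinuousOn ρ (Ici 0))
    (hρ : ∀ t ∈ Ici (0 : ℝ), ∀ i : Fin d,
      HasDerivWithinAt (fun τ => ρ τ i.castSucc) (ρ t i.succ) (Ici 0) t)
    (X₀ : State (d + 1) p) (Z₀ : Vec p) (Θ₀ : Vec m) (Φ₀ : ℝ) :
    ∃ X Z Θ Φ, Motion F θ σ C ρ (Ici 0) X Z Θ Φ ∧ X 0 = X₀ ∧ Z 0 = Z₀ ∧ Θ 0 = Θ₀ ∧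
      Φ 0 = Φ₀ := by
  have hG := locallyLipschitz_closedLoopField (θ := θ) (C := C) hF
  obtain ⟨R, hR, hbound⟩ := exists_bound_of_motion (θ := θ) hF hC hσb hρb hρ X₀ Z₀ Θ₀ Φ₀
  obtain ⟨Mσ, hMσ⟩ := hσb
  obtain ⟨Mρ, hMρ⟩ := hρb
  suffices h : ∃ u : ℝ → Phase d p m, u 0 = (X₀, Z₀, Θ₀, Φ₀) ∧ ∀ t ∈ Ici (0 : ℝ),
      HasDerivWithinAt u (closedLoopField F θ C (σ t, ρ t, u t)) (Ici 0) t by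
    obtain ⟨u, hu0, hu⟩ := h
    exact ⟨_, _, _, _, motion_of_hasDerivWithinAt hu, by rw [hu0], by rw [hu0], by rw [hu0],
      by rw [hu0]⟩
  refine exists_hasDerivWithinAt_Ici_of_bound
    (f := fun t u => closedLoopField F θ C (σ t, ρ t, u)) (fun u => ?_)
    (fun T R' => ?_) (fun T hT => ⟨|Φ₀| + R * T + R, fun u τ hτ hu0 hu => ?_⟩)
  · exact hG.continuous.comp_continuousOn (hσ.prodMk (hρc.prodMk continuousOn_const))
  -- Time enters only through the bounded signals `σ` and `ρ`, so one compact ball in all variables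
  -- gives a Lipschitz constant uniform in `t`.
  · obtain ⟨K, hK⟩ := hG.locallyLipschitzOn.exists_lipschitzOnWith_of_compact
      (isCompact_closedBall (0 : Vec p × State (d + 1) p × Phase d p m) (max Mσ (max Mρ R')))
    refine ⟨K, fun t ht => ?_⟩
    have hmem : MapsTo (fun u : Phase d p m => (σ t, ρ t, u)) (Metric.closedBall 0 R')
        (Metric.closedBall 0 (max Mσ (max Mρ R'))) := fun u hu => by
      rw [mem_closedBall_zero_iff] at hu ⊢
      simp only [Prod.norm_mk]
      exact max_le_max (hMσ t ht.1) (max_le_max (hMρ t ht.1) hu)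
    have h2 : LipschitzWith 1 fun u : Phase d p m => (σ t, ρ t, u) :=
      LipschitzWith.of_edist_le fun u v => by simp [Prod.edist_eq]
    have h3 := hK.comp h2.lipschitzOnWith hmem
    rw [mul_one] at h3
    exact h3
  · have hm := motion_of_hasDerivWithinAt hu
    obtain ⟨h1, h2, h3, h4⟩ := hbound τ _ _ _ _ hm (by rw [hu0]) (by rw [hu0]) (by rw [hu0])
      (by rw [hu0]) τ (right_mem_Icc.2 hτ.1)
    have h5 : R * τ ≤ R * T := by gcongr; exact hτ.2
    have h6 : 0 ≤ R * T := mul_nonneg hR hT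
    have h7 := abs_nonneg Φ₀
    simp only [Prod.norm_def, Real.norm_eq_abs]
    refine max_le ?_ (max_le ?_ (max_le ?_ ?_)) <;> linarith

end Existence

/-! ### Equivalence of the integral form and the first-order form -/

section Conversion

variable {d p m : ℕ}

theorem hasDerivWithinAt_der {N j : ℕ} {x : ℝ → Vec p} (hx : ContDiffOn ℝ N x (Ici 0))
    (hj : j < N) {t : ℝ} (ht : t ∈ Ici (0 : ℝ)) :
    HasDerivWithinAt (der j x) (der (j + 1) x t) (Ici 0) t := by
  have h := (hx.differentiableOn_iteratedDerivWithin (m := j) (by exact_mod_cast hj)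
    (uniqueDiffOn_Ici 0) t ht).hasDerivWithinAt
  rw [← iteratedDerivWithin_succ] at h
  exact h

theorem continuousOn_der {N j : ℕ} {x : ℝ → Vec p} (hx : ContDiffOn ℝ N x (Ici 0))
    (hj : j ≤ N) : ContinuousOn (der j x) (Ici 0) :=
  hx.continuousOn_iteratedDerivWithin (by exact_mod_cast hj) (uniqueDiffOn_Ici 0)

theorem continuousOn_state {N : ℕ} {x : ℝ → Vec p} (hx : ContDiffOn ℝ N x (Ici 0)) :
    ContinuousOn (state N x) (Ici 0) :=
  continuousOn_pi.2 fun i => continuousOn_der hx i.2.le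

theorem der_err {N j : ℕ} {r x : ℝ → Vec p} (hr : ContDiffOn ℝ N r (Ici 0))
    (hx : ContDiffOn ℝ N x (Ici 0)) (hj : j ≤ N) {t : ℝ} (ht : t ∈ Ici (0 : ℝ)) :
    der j (err r x) t = der j x t - der j r t := by
  have hj' : ((j : ℕ) : WithTop ℕ∞) ≤ N := by exact_mod_cast hj
  exact iteratedDerivWithin_sub ht (uniqueDiffOn_Ici 0) ((hx t ht).of_le hj')
    ((hr t ht).of_le hj')

theorem state_err {N : ℕ} {r x : ℝ → Vec p} (hr : ContDiffOn ℝ N r (Ici 0))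
    (hx : ContDiffOn ℝ N x (Ici 0)) {t : ℝ} (ht : t ∈ Ici (0 : ℝ)) :
    state N (err r x) t = state N x t - state N r t :=
  funext fun i => der_err hr hx i.2.le ht

theorem der_congr {x x' : ℝ → Vec p} (h : EqOn x x' (Ici 0)) (j : ℕ) :
    EqOn (der j x) (der j x') (Ici 0) := iteratedDerivWithin_congr h

theorem der_zero (x : ℝ → Vec p) : der 0 x = x := iteratedDerivWithin_zero

theorem der_eq_of_chain {X : ℝ → State (d + 1) p}
    (hX : ∀ t ∈ Ici (0 : ℝ), ∀ i : Fin d,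
      HasDerivWithinAt (fun τ => X τ i.castSucc) (X t i.succ) (Ici 0) t) (i : Fin (d + 1)) :
    EqOn (der i fun t => X t 0) (fun t => X t i) (Ici 0) := by
  induction i using Fin.induction with
  | zero => intro t _; exact congrFun (der_zero _) t
  | succ i ih =>
    intro t ht
    have h1 : der (i + 1) (fun t => X t 0) t =
        derivWithin (der i.castSucc fun t => X t 0) (Ici 0) t := by
      rw [der, iteratedDerivWithin_succ]; rfl
    rw [Fin.val_succ, h1, derivWithin_congr ih (ih ht)]
    exact (hX t ht i).derivWithin (uniqueDiffOn_Ici 0 t ht)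

/-- Freezing `h` at its value at `0` for negative times makes it continuous on `ℝ` without changing
the integrals over `[0, t]`, so the two-sided fundamental theorem applies. -/
theorem hasDerivWithinAt_integral {h : ℝ → Vec p} (hh : ContinuousOn h (Ici 0)) {t : ℝ}
    (ht : t ∈ Ici (0 : ℝ)) :
    HasDerivWithinAt (fun t => ∫ τ in (0 : ℝ)..t, h τ) (h t) (Ici 0) t := by
  have hc : Continuous fun τ => h (max τ 0) :=
    hh.comp_continuous (by fun_prop) fun τ => mem_Ici.2 (le_max_right _ _)
  have h1 := (hc.integral_hasStrictDerivAt 0 t).hasDerivAt.hasDerivWithinAt (s := Ici 0)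
  have ht' : max t 0 = t := max_eq_left ht
  rw [ht'] at h1
  have heq : EqOn (fun t => ∫ τ in (0 : ℝ)..t, h τ) (fun t => ∫ τ in (0 : ℝ)..t, h (max τ 0))
      (Ici 0) := fun s hs => by
    refine intervalIntegral.integral_congr fun τ hτ => ?_
    rw [uIcc_of_le hs] at hτ
    simp only [max_eq_left hτ.1]
  exact h1.congr heq (heq ht)

variable {F : State (d + 1) p → Matrix (Fin p) (Fin m) ℝ} {θ : Vec m} {σ : ℝ → Vec p}
  {C : Params (d + 1) m} {r x : ℝ → Vec p} {θhat : ℝ → Vec m} {φ : ℝ → ℝ}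

theorem sliding_eq (hr : ContDiffOn ℝ (d + 1 : ℕ) r (Ici 0))
    (hx : ContDiffOn ℝ (d + 1 : ℕ) x (Ici 0)) {t : ℝ} (ht : t ∈ Ici (0 : ℝ)) :
    sliding C r x t = slide C.coef (state (d + 1) x t - state (d + 1) r t) := by
  rw [← state_err hr hx ht]
  rfl

theorem eta_eq (hr : ContDiffOn ℝ (d + 1 : ℕ) r (Ici 0))
    (hx : ContDiffOn ℝ (d + 1 : ℕ) x (Ici 0)) {t : ℝ} (ht : t ∈ Ici (0 : ℝ)) :
    eta F C r x θhat φ t =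
      feedback F C (state (d + 1) x t) (state (d + 1) r t) (θhat t) (φ t) := by
  rw [eta, gain, sliding_eq hr hx ht, feedback, ← state_err hr hx ht]
  rfl

theorem hasDerivWithinAt_auxErr (hF : ∀ i j, LocallyLipschitz fun ξ => F ξ i j)
    (hσ : ContinuousOn σ (Ici 0)) (hr : ContDiffOn ℝ (d + 1 : ℕ) r (Ici 0))
    (hx : ContDiffOn ℝ (d + 1 : ℕ) x (Ici 0)) (hθhat : ContinuousOn θhat (Ici 0))
    (hφ : ContinuousOn φ (Ici 0)) {t : ℝ} (ht : t ∈ Ici (0 : ℝ)) :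
    HasDerivWithinAt (auxErr F σ C r x θhat φ)
      (der (d + 1) x t - (mv (F (state (d + 1) x t)) (θhat t) + σ t + eta F C r x θhat φ t))
      (Ici 0) t := by
  have hX := continuousOn_state hx
  have hη : ContinuousOn (eta F C r x θhat φ) (Ici 0) := by
    have hG : Continuous fun q : State (d + 1) p × State (d + 1) p × Vec m × ℝ =>
        feedback F C q.1 q.2.1 q.2.2.1 q.2.2.2 :=
      (locallyLipschitz_feedback hF (contDiff_fst (𝕜 := ℝ)).locallyLipschitz
        ((contDiff_fst (𝕜 := ℝ)).comp contDiff_snd).locallyLipschitz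
        ((contDiff_fst (𝕜 := ℝ)).comp (contDiff_snd.comp contDiff_snd)).locallyLipschitz
        ((contDiff_snd (𝕜 := ℝ)).comp (contDiff_snd.comp contDiff_snd)).locallyLipschitz).continuous
    exact (hG.comp_continuousOn (hX.prodMk ((continuousOn_state hr).prodMk
      (hθhat.prodMk hφ)))).congr fun t ht => eta_eq hr hx ht
  have hG : Continuous fun q : State (d + 1) p × Vec m => mv (F q.1) q.2 :=
    (locallyLipschitz_mv (fun i j => (hF i j).comp LipschitzWith.prod_fst.locallyLipschitz)
      LipschitzWith.prod_snd.locallyLipschitz).continuous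
  have hint := hasDerivWithinAt_integral
    (((hG.comp_continuousOn (hX.prodMk hθhat)).add hσ).add hη) ht
  exact ((hasDerivWithinAt_der hx (Nat.lt_succ_self d) ht).sub hint).sub_const _

/-- At time zero the integral is empty, so the auxiliary error starts at `e^{(n-1)}(0)`. This ties
the auxiliary error to the tracking error and fixes the initial value of `Z` in the existence proof.
-/
theorem auxErr_zero : auxErr F σ C r x θhat φ 0 = der d x 0 - der d r 0 := by
  simp [auxErr, aux]

/-- Inserting the control law into the derivative of `z` cancels `σ` and `η` and leaves an ordinary
differential equation without integrals. -/
theorem IsClosedLoop.motion (hF : ∀ i j, LocallyLipschitz fun ξ => F ξ i j)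
    (hσ : ContinuousOn σ (Ici 0)) (hr : ContDiffOn ℝ (d + 1 : ℕ) r (Ici 0))
    (h : IsClosedLoop F σ C r x θhat φ θ) :
    Motion F θ σ C (state (d + 1) r) (Ici 0) (state (d + 1) x) (auxErr F σ C r x θhat φ)
      θhat φ := by
  have hx := h.contDiffOn
  refine ⟨fun t ht i => ?_, fun t ht => ?_, fun t ht => ?_, h.estimate_update, fun t ht => ?_⟩
  · exact hasDerivWithinAt_der hx (Nat.lt_succ_of_lt i.2) ht
  · refine (hasDerivWithinAt_der hx (Nat.lt_succ_self d) ht).congr_deriv ?_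
    rw [h.plant t ht, control, eta_eq hr hx ht]
  · refine (hasDerivWithinAt_auxErr hF hσ hr hx
      (fun t ht => (h.estimate_update t ht).continuousWithinAt)
      (fun t ht => (h.gain_update t ht).continuousWithinAt) ht).congr_deriv ?_
    rw [h.plant t ht, control, mv_sub]
    abel
  · refine (h.gain_update t ht).congr_deriv ?_
    rw [sliding_eq hr hx ht, real_inner_self_eq_norm_sq]

/-- Here `Z` is an independent state. It coincides with the integral expression `auxErr` because
both have the same derivative and, by `hZ`, the same initial value. -/
theorem Motion.isClosedLoop (hF : ∀ i j, LocallyLipschitz fun ξ => F ξ i j)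
    (hσ : ContinuousOn σ (Ici 0)) (hr : ContDiffOn ℝ (d + 1 : ℕ) r (Ici 0))
    {X : ℝ → State (d + 1) p} {Z : ℝ → Vec p}
    (h : Motion F θ σ C (state (d + 1) r) (Ici 0) X Z θhat φ)
    (hZ : Z 0 = X 0 (Fin.last d) - der d r 0) :
    IsClosedLoop F σ C r (fun t => X t 0) θhat φ θ ∧
      EqOn (state (d + 1) fun t => X t 0) X (Ici 0) := by
  have hder := der_eq_of_chain h.chain
  have hst : EqOn (state (d + 1) fun t => X t 0) X (Ici 0) := fun t ht =>
    funext fun i => hder i ht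
  set x : ℝ → Vec p := fun t => X t 0 with hxdef
  have hX : ContinuousOn X (Ici 0) := continuousOn_pi.2 fun i => by
    refine Fin.lastCases ?_ (fun i => ?_) i
    · exact fun t ht => (h.top t ht).continuousWithinAt
    · exact fun t ht => (h.chain t ht i).continuousWithinAt
  have hZc : ContinuousOn Z (Ici 0) := fun t ht => (h.aux t ht).continuousWithinAt
  have hΘc : ContinuousOn θhat (Ici 0) := fun t ht => (h.estimate t ht).continuousWithinAt
  have hΦc : ContinuousOn φ (Ici 0) := fun t ht => (h.gain t ht).continuousWithinAt
  -- The prospective derivative of order `d + 1`; its continuity is what makes `x` of class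
  -- `C^{d+1}`.
  set T : ℝ → Vec p := fun t => mv (F (X t)) θ + (σ t + (-(C.k • Z t) +
    feedback F C (X t) (state (d + 1) r t) (θhat t) (φ t))) with hT
  have hTc : ContinuousOn T (Ici 0) := by
    have h1 := (continuous_fst.comp
      (locallyLipschitz_closedLoopField (θ := θ) (C := C) hF).continuous).comp_continuousOn
      (hσ.prodMk ((continuousOn_state hr).prodMk (hX.prodMk (hZc.prodMk (hΘc.prodMk hΦc)))))
    have h2 := continuousOn_pi.1 h1 (Fin.last d)
    simp only [Function.comp_apply, closedLoopField, shiftAppend_last] at h2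
    exact h2
  have hlow : ∀ j ≤ d, ∀ t ∈ Ici (0 : ℝ), HasDerivWithinAt (der j x)
      (if hj : j < d then X t (Fin.succ ⟨j, hj⟩) else T t) (Ici 0) t := by
    intro j hj t ht
    rcases hj.lt_or_eq with hj | rfl
    · rw [dif_pos hj]
      exact (h.chain t ht ⟨j, hj⟩).congr (hder (Fin.castSucc ⟨j, hj⟩))
        (hder (Fin.castSucc ⟨j, hj⟩) ht)
    · rw [dif_neg (lt_irrefl _)]
      exact (h.top t ht).congr (hder (Fin.last j)) (hder (Fin.last j) ht)
  have htop : EqOn (der (d + 1) x) T (Ici 0) := fun t ht => by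
    have h1 := (hlow d le_rfl t ht).derivWithin (uniqueDiffOn_Ici 0 t ht)
    rw [dif_neg (lt_irrefl _)] at h1
    rw [← h1, der, iteratedDerivWithin_succ]
    rfl
  have hx : ContDiffOn ℝ (d + 1 : ℕ) x (Ici 0) := by
    refine contDiffOn_of_continuousOn_differentiableOn_deriv (n := ((d + 1 : ℕ) : ℕ∞))
      (fun j hj => ?_) fun j hj => ?_
    · have hj' : j ≤ d + 1 := by exact_mod_cast hj
      rcases hj'.lt_or_eq with hj' | rfl
      · exact fun t ht => (hlow j (Nat.lt_succ_iff.1 hj') t ht).continuousWithinAt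
      · exact hTc.congr htop
    · have hj' : j < d + 1 := by exact_mod_cast hj
      exact fun t ht => (hlow j (Nat.lt_succ_iff.1 hj') t ht).differentiableWithinAt
  have hη : ∀ t ∈ Ici (0 : ℝ), eta F C r x θhat φ t =
      feedback F C (X t) (state (d + 1) r t) (θhat t) (φ t) := fun t ht => by
    rw [eta_eq hr hx ht, hst ht]
  have haux : EqOn (auxErr F σ C r x θhat φ) Z (Ici 0) := by
    intro t ht
    have hd : ∀ u ∈ Ici (0 : ℝ), HasDerivWithinAt
        (fun u => auxErr F σ C r x θhat φ u - Z u) 0 (Ici 0) u := fun u hu => by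
      refine ((hasDerivWithinAt_auxErr hF hσ hr hx hΘc hΦc hu).sub (h.aux u hu)).congr_deriv ?_
      rw [htop hu, hst hu, hη u hu, mv_sub]
      simp only [hT]
      abel
    have := constant_of_has_deriv_right_zero (a := 0) (b := t)
      (fun u hu => ((hd u hu.1).continuousWithinAt).mono Icc_subset_Ici_self)
      (fun u hu => (hd u hu.1).mono (Ici_subset_Ici.2 hu.1)) t (right_mem_Icc.2 ht)
    have h0 : der d x 0 = X 0 (Fin.last d) := hder (Fin.last d) (mem_Ici.2 le_rfl)
    rw [auxErr_zero, hZ, h0, sub_self, sub_eq_zero] at this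
    exact this
  refine ⟨⟨hx, fun t ht => ?_, fun t ht => ?_, fun t ht => ?_⟩, hst⟩
  · rw [htop ht, control, haux ht, hη t ht, hst ht]
  · rw [sliding_eq hr hx ht, hst ht, real_inner_self_eq_norm_sq]
    exact h.gain t ht
  · rw [haux ht, hst ht]
    exact h.estimate t ht

end Conversion


/-! ### Convergence and noninvasive control for natural responses -/

section Convergence

variable {d p m : ℕ} {F : State (d + 1) p → Matrix (Fin p) (Fin m) ℝ} {θ : Vec m}
  {σ : ℝ → Vec p} {C : Params (d + 1) m} {ρ : ℝ → State (d + 1) p} {X : ℝ → State (d + 1) p}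
  {Z : ℝ → Vec p} {Θ : ℝ → Vec m} {Φ : ℝ → ℝ}

theorem slide_zero (lam : Fin d → ℝ) : slide lam (0 : State (d + 1) p) = 0 := by
  simp [slide]

theorem norm_slide_le (lam : Fin d → ℝ) (E : State (d + 1) p) :
    ‖slide lam E‖ ≤ (1 + ∑ i, |lam i|) * ‖E‖ := by
  rw [add_mul, one_mul, Finset.sum_mul]
  refine (norm_add_le _ _).trans (add_le_add (norm_le_pi_norm E _) ?_)
  refine (norm_sum_le _ _).trans (Finset.sum_le_sum fun i _ => ?_)
  rw [norm_smul, Real.norm_eq_abs]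
  gcongr
  exact norm_le_pi_norm E _

theorem Motion.exists_bound (hF : ∀ i j, LocallyLipschitz fun ξ => F ξ i j)
    (hC : C.Admissible) (hσ : BoundedSignal σ) (hρb : BoundedSignal ρ)
    (hρ : ∀ t ∈ Ici (0 : ℝ), ∀ i : Fin d,
      HasDerivWithinAt (fun τ => ρ τ i.castSucc) (ρ t i.succ) (Ici 0) t)
    (hm : Motion F θ σ C ρ (Ici 0) X Z Θ Φ) :
    ∃ R, 0 ≤ R ∧ ∀ t ∈ Ici (0 : ℝ), ‖X t‖ ≤ R ∧ ‖Z t‖ ≤ R ∧ ‖Θ t‖ ≤ R ∧ ‖ρ t‖ ≤ R := by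
  obtain ⟨R, hR, h⟩ := exists_bound_of_motion (θ := θ) hF hC hσ hρb hρ (X 0) (Z 0) (Θ 0) (Φ 0)
  obtain ⟨M, hM⟩ := hρb
  refine ⟨max R M, le_max_of_le_left hR, fun t ht => ?_⟩
  obtain ⟨h1, h2, h3, -⟩ := h t X Z Θ Φ (hm.mono Icc_subset_Ici_self) rfl rfl rfl rfl t
    (right_mem_Icc.2 ht)
  exact ⟨h1.trans (le_max_left _ _), h2.trans (le_max_left _ _), h3.trans (le_max_left _ _),
    (hM t ht).trans (le_max_right _ _)⟩

/-- Integrates the adaptation law. With `c = 0` it says that `Φ` never falls below its initial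
value; with `c > 0`, that a persistent sliding error forces linear growth. -/
theorem Motion.gain_le (hC : C.Admissible) (hm : Motion F θ σ C ρ (Ici 0) X Z Θ Φ) {t c : ℝ}
    (ht : 0 ≤ t) (hc : ∀ u ∈ Ioo 0 t, c ≤ ‖slide C.coef (X u - ρ u)‖ ^ 2) :
    Φ 0 + C.γ * c * t ≤ Φ t := by
  have := sub_le_mul_sub_of_hasDerivWithinAt_le (c := -(C.γ * c)) ht
    (fun u hu => ((hm.gain u hu.1).mono Icc_subset_Ici_self).neg) fun u hu => by
      have := hC.γ_pos
      have : C.γ * c ≤ C.γ * ‖slide C.coef (X u - ρ u)‖ ^ 2 := by gcongr; exact hc u hu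
      linarith
  simp only [Pi.neg_apply] at this
  linarith

/-- The sliding variable when the reference is a natural response. -/
theorem Motion.hasDerivWithinAt_slide {s : Set ℝ} (hm : Motion F θ σ C ρ s X Z Θ Φ)
    (hρ : ∀ t ∈ s, ∀ i : Fin d,
      HasDerivWithinAt (fun τ => ρ τ i.castSucc) (ρ t i.succ) s t)
    (hρtop : ∀ t ∈ s, HasDerivWithinAt (fun τ => ρ τ (Fin.last d))
      (mv (F (ρ t)) θ + σ t) s t) {t : ℝ} (ht : t ∈ s) :
    HasDerivWithinAt (fun t => slide C.coef (X t - ρ t))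
      (mv (F (X t) - F (ρ t)) θ - C.k • Z t - Φ t • slide C.coef (X t - ρ t)
        - (‖mv (F (X t) - F (ρ t)) (Θ t)‖ + C.κ) • satVec C.ε (slide C.coef (X t - ρ t))) s t := by
  have h1 : HasDerivWithinAt (fun t => ∑ i : Fin d, C.coef i • (X t - ρ t) i.castSucc)
      (∑ i : Fin d, C.coef i • (X t - ρ t) i.succ) s t :=
    HasDerivWithinAt.fun_sum fun i _ => ((hm.chain t ht i).sub (hρ t ht i)).const_smul (C.coef i)
  refine (((hm.top t ht).sub (hρtop t ht)).add h1).congr_deriv ?_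
  rw [feedback, sub_mv _ _ θ]
  abel

/-- If the reference is a natural response, the errors decay and the adaptive gain is bounded. -/
theorem Motion.tendsto_zero (hF : ∀ i j, LocallyLipschitz fun ξ => F ξ i j)
    (hC : C.Admissible) (hσ : BoundedSignal σ) (hρb : BoundedSignal ρ)
    (hρ : ∀ t ∈ Ici (0 : ℝ), ∀ i : Fin d,
      HasDerivWithinAt (fun τ => ρ τ i.castSucc) (ρ t i.succ) (Ici 0) t)
    (hρtop : ∀ t ∈ Ici (0 : ℝ), HasDerivWithinAt (fun τ => ρ τ (Fin.last d))
      (mv (F (ρ t)) θ + σ t) (Ici 0) t)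
    (hm : Motion F θ σ C ρ (Ici 0) X Z Θ Φ) :
    Tendsto (fun t => X t - ρ t) atTop (𝓝 0) ∧ Tendsto Z atTop (𝓝 0) ∧
      ∃ M, ∀ t ∈ Ici (0 : ℝ), |Φ t| ≤ M := by
  obtain ⟨R, hR, hb⟩ := hm.exists_bound hF hC hσ hρb hρ
  obtain ⟨L, hL0, hL⟩ := exists_norm_sub_mv_le hF R
  obtain ⟨B, hB0, hB⟩ := exists_norm_mv_le hF R
  obtain ⟨a, ha, K, hK, hLy⟩ := exists_lyapunov_of_hurwitz p C.coef hC.hurwitz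
  obtain ⟨D, -, hEn⟩ := exists_energy F θ σ ρ hC.S_posDef
  obtain ⟨H, hH⟩ := hEn _ X Z Θ Φ hm
  obtain ⟨V, V', hV⟩ := hLy (Ici 0) (fun t => X t - ρ t) fun t ht i =>
    (hm.chain t ht i).sub (hρ t ht i)
  have hγ := hC.γ_pos
  have hk := hC.k_pos
  set y : ℝ → Vec p := fun t => slide C.coef (X t - ρ t) with hy
  set y' : ℝ → Vec p := fun t => mv (F (X t) - F (ρ t)) θ - C.k • Z t - Φ t • y t
        - (‖mv (F (X t) - F (ρ t)) (Θ t)‖ + C.κ) • satVec C.ε (y t) with hy'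
  have hyd : ∀ t ∈ Ici (0 : ℝ), HasDerivWithinAt y (y' t) (Ici 0) t := fun t ht =>
    hm.hasDerivWithinAt_slide hρ hρtop ht
  set P := L * ‖θ‖ with hP
  have hP0 : 0 ≤ P := by positivity
  have hinner : ∀ t ∈ Ici (0 : ℝ), inner ℝ (y t) (y' t) ≤
      P * ‖y t‖ * ‖X t - ρ t‖ + C.k * (‖y t‖ * ‖Z t‖) - Φ t * ‖y t‖ ^ 2 := fun t ht => by
    obtain ⟨hX, hZ, hΘ, hρR⟩ := hb t ht
    simp only [hy', inner_sub_right, inner_smul_right, real_inner_self_eq_norm_sq]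
    have h1 : inner ℝ (y t) (mv (F (X t) - F (ρ t)) θ) ≤ P * ‖y t‖ * ‖X t - ρ t‖ := by
      refine (real_inner_le_norm _ _).trans ?_
      calc ‖y t‖ * ‖mv (F (X t) - F (ρ t)) θ‖ ≤ ‖y t‖ * (L * ‖X t - ρ t‖ * ‖θ‖) := by
            gcongr; exact hL _ _ hX hρR θ
        _ = _ := by rw [hP]; ring
    have h2 : -(C.k * inner ℝ (y t) (Z t)) ≤ C.k * (‖y t‖ * ‖Z t‖) := by
      rw [← mul_neg, ← inner_neg_left, ← norm_neg (y t)]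
      gcongr
      exact real_inner_le_norm _ _
    have h3 : 0 ≤ (‖mv (F (X t) - F (ρ t)) (Θ t)‖ + C.κ) * inner ℝ (y t) (satVec C.ε (y t)) :=
      mul_nonneg (add_nonneg (norm_nonneg _) hC.κ_pos.le) (inner_satVec_nonneg hC.ε_pos _)
    linarith
  have hΦ0 : ∀ t ∈ Ici (0 : ℝ), Φ 0 ≤ Φ t := fun t ht => by
    simpa using hm.gain_le hC (c := 0) ht fun u _ => by positivity
  set f : ℝ → ℝ := fun t => V t + ‖y t‖ ^ 2 + ‖Z t‖ ^ 2 with hf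
  -- A fictitious constant gain, unknown to the controller. Differentiating `(Φ - Ψ)² / (2γ)`
  -- replaces the actual damping `-Φ‖y‖²` by `-Ψ‖y‖²`, and `Ψ` exceeds all coefficients of `‖y‖²`
  -- produced by Young's inequality and by `V'`.
  set Ψ := 2 + K * P ^ 2 + C.k ^ 2 + 2 * K / a with hΨ
  set N : ℝ → ℝ := fun t =>
    1 / 2 * ‖y t‖ ^ 2 + 2 / a * V t + 1 / C.k * H t + 1 / (2 * C.γ) * (Φ t - Ψ) ^ 2 with hN
  have hfd : ∀ t ∈ Ici (0 : ℝ), HasDerivWithinAt f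
      (V' t + 2 * inner ℝ (y t) (y' t) +
        2 * inner ℝ (Z t) (mv (F (X t)) (θ - Θ t) - C.k • Z t)) (Ici 0) t := fun t ht =>
    ((hV t ht).1.add (hyd t ht).norm_sq).add (hm.aux t ht).norm_sq
  have hNd : ∀ t ∈ Ici (0 : ℝ), HasDerivWithinAt N
      (1 / 2 * (2 * inner ℝ (y t) (y' t)) + 2 / a * V' t + 1 / C.k * (-2 * C.k * ‖Z t‖ ^ 2) +
        1 / (2 * C.γ) * (2 * (Φ t - Ψ) * (C.γ * ‖y t‖ ^ 2))) (Ici 0) t := fun t ht => by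
    have h1 := ((hm.gain t ht).sub_const Ψ).fun_pow 2
    simp only [Nat.cast_ofNat, Nat.add_one_sub_one, pow_one] at h1
    exact ((((hyd t ht).norm_sq.const_mul (1 / 2)).add ((hV t ht).1.const_mul (2 / a))).add
      ((hH t ht).1.const_mul (1 / C.k))).add (h1.const_mul (1 / (2 * C.γ)))
  have hf0 : ∀ t ∈ Ici (0 : ℝ), 0 ≤ f t := fun t ht => by
    have := (hV t ht).2.1
    positivity
  have hN0 : ∀ t ∈ Ici (0 : ℝ), 1 / (2 * C.γ) * (Φ t - Ψ) ^ 2 ≤ N t := fun t ht => by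
    have h1 := (hV t ht).2.1
    have h2 := (sq_nonneg ‖Z t‖).trans (hH t ht).2.1
    have h3 : 0 ≤ 1 / 2 * ‖y t‖ ^ 2 + 2 / a * V t + 1 / C.k * H t := by positivity
    simp only [hN]
    linarith
  have hNf : ∀ t ∈ Ici (0 : ℝ), 1 / 2 * (2 * inner ℝ (y t) (y' t)) + 2 / a * V' t +
      1 / C.k * (-2 * C.k * ‖Z t‖ ^ 2) +
      1 / (2 * C.γ) * (2 * (Φ t - Ψ) * (C.γ * ‖y t‖ ^ 2)) ≤ -f t := fun t ht => by
    obtain ⟨-, hV0, hV', hE, -⟩ := hV t ht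
    have h1 := hinner t ht
    have h2 : 2 / a * V' t ≤ 2 / a * (-a * V t + K * ‖y t‖ ^ 2) := by gcongr
    have h3 : 2 / a * (-a * V t + K * ‖y t‖ ^ 2) = -2 * V t + 2 * K / a * ‖y t‖ ^ 2 := by
      field_simp
    have h4 : 1 / C.k * (-2 * C.k * ‖Z t‖ ^ 2) = -2 * ‖Z t‖ ^ 2 := by field_simp
    have h5 : 1 / (2 * C.γ) * (2 * (Φ t - Ψ) * (C.γ * ‖y t‖ ^ 2)) =
        (Φ t - Ψ) * ‖y t‖ ^ 2 := by field_simp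
    have h6 : P * ‖y t‖ * ‖X t - ρ t‖ ≤
        1 / 2 * (V t + ‖y t‖ ^ 2) + 1 / 2 * (K * P ^ 2) * ‖y t‖ ^ 2 := by
      have e : 1 / 2 * (‖X t - ρ t‖ ^ 2 / K) + 1 / 2 * (K * P ^ 2) * ‖y t‖ ^ 2 -
          P * ‖y t‖ * ‖X t - ρ t‖ = (‖X t - ρ t‖ - K * P * ‖y t‖) ^ 2 / (2 * K) := by
        field_simp; ring
      have e1 : 0 ≤ (‖X t - ρ t‖ - K * P * ‖y t‖) ^ 2 / (2 * K) := by positivity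
      have e2 : ‖X t - ρ t‖ ^ 2 / K ≤ V t + ‖y t‖ ^ 2 := by
        rw [div_le_iff₀ hK, mul_comm]; exact hE
      linarith
    have h7 : C.k * (‖y t‖ * ‖Z t‖) ≤ 1 / 2 * C.k ^ 2 * ‖y t‖ ^ 2 + 1 / 2 * ‖Z t‖ ^ 2 := by
      nlinarith [sq_nonneg (C.k * ‖y t‖ - ‖Z t‖)]
    have h8 : 0 ≤ K * P ^ 2 * ‖y t‖ ^ 2 := by positivity
    have h9 : 0 ≤ C.k ^ 2 * ‖y t‖ ^ 2 := by positivity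
    have h10 : Ψ * ‖y t‖ ^ 2 = 2 * ‖y t‖ ^ 2 + K * P ^ 2 * ‖y t‖ ^ 2 + C.k ^ 2 * ‖y t‖ ^ 2 +
        2 * K / a * ‖y t‖ ^ 2 := by rw [hΨ]; ring
    have h11 := sq_nonneg ‖y t‖
    have h12 := sq_nonneg ‖Z t‖
    simp only [hf]
    linarith
  set Q := 1 + ∑ i, |C.coef i|
  have hQ0 : 0 ≤ Q := by positivity
  set Y := Q * (R + R)
  have hEb : ∀ t ∈ Ici (0 : ℝ), ‖X t - ρ t‖ ≤ R + R := fun t ht => by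
    obtain ⟨hX, -, -, hρR⟩ := hb t ht
    exact (norm_sub_le _ _).trans (add_le_add hX hρR)
  have hyb : ∀ t ∈ Ici (0 : ℝ), ‖y t‖ ≤ Y := fun t ht =>
    (norm_slide_le _ _).trans (mul_le_mul_of_nonneg_left (hEb t ht) hQ0)
  have hY0 : 0 ≤ Y := by positivity
  -- Only an upper bound on the derivative of `f` is needed, so no upper bound on `Φ` is required
  -- yet: its term is damping, and `Φ ≥ Φ 0` suffices.
  have hfK : ∀ t ∈ Ici (0 : ℝ), V' t + 2 * inner ℝ (y t) (y' t) +
      2 * inner ℝ (Z t) (mv (F (X t)) (θ - Θ t) - C.k • Z t) ≤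
      K * Y ^ 2 + 2 * (P * Y * (R + R) + C.k * (Y * R) + |Φ 0| * Y ^ 2) +
        2 * (R * (B * (‖θ‖ + R))) := fun t ht => by
    obtain ⟨hX, hZ, hΘ, hρR⟩ := hb t ht
    obtain ⟨-, hV0, hV', -, -⟩ := hV t ht
    have hyt := hyb t ht
    have hEt := hEb t ht
    have h1 : V' t ≤ K * Y ^ 2 := by
      have e1 : K * ‖y t‖ ^ 2 ≤ K * Y ^ 2 := by gcongr
      have e2 : 0 ≤ a * V t := by positivity
      linarith
    have h2 := hinner t ht
    have h3 : P * ‖y t‖ * ‖X t - ρ t‖ ≤ P * Y * (R + R) := by gcongr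
    have h4 : C.k * (‖y t‖ * ‖Z t‖) ≤ C.k * (Y * R) := by gcongr
    have h5 : -Φ t * ‖y t‖ ^ 2 ≤ |Φ 0| * Y ^ 2 := by
      calc -Φ t * ‖y t‖ ^ 2 ≤ |Φ 0| * ‖y t‖ ^ 2 := by
            gcongr
            linarith [hΦ0 t ht, neg_abs_le (Φ 0)]
        _ ≤ _ := by gcongr
    have h6 : inner ℝ (Z t) (mv (F (X t)) (θ - Θ t) - C.k • Z t) ≤ R * (B * (‖θ‖ + R)) := by
      rw [inner_sub_right, inner_smul_right, real_inner_self_eq_norm_sq]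
      have e1 : 0 ≤ C.k * ‖Z t‖ ^ 2 := by positivity
      have e2 : inner ℝ (Z t) (mv (F (X t)) (θ - Θ t)) ≤ R * (B * (‖θ‖ + R)) := by
        refine (real_inner_le_norm _ _).trans ?_
        gcongr
        refine (hB _ hX _).trans ?_
        gcongr
        exact (norm_sub_le _ _).trans (by gcongr)
      linarith
    linarith
  have hlim : Tendsto f atTop (𝓝 0) := tendsto_zero_of_hasDerivWithinAt_le hfd hNd hf0
    (fun t ht => le_trans (by positivity) (hN0 t ht)) hfK hNf
  have hsq : ∀ {W : Type} [NormedAddCommGroup W] (g : ℝ → W) (c : ℝ),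
      (∀ t ∈ Ici (0 : ℝ), ‖g t‖ ^ 2 ≤ c * f t) → Tendsto g atTop (𝓝 0) := by
    intro W _ g c hg
    have h1 : Tendsto (fun t => √(c * f t)) atTop (𝓝 0) := by
      have := (hlim.const_mul c).sqrt
      simpa using this
    refine squeeze_zero_norm' ?_ h1
    filter_upwards [eventually_ge_atTop 0] with t ht
    exact Real.le_sqrt_of_sq_le (hg t ht)
  refine ⟨hsq _ K fun t ht => ?_, hsq _ 1 fun t ht => ?_, √(2 * C.γ * N 0) + |Ψ|, fun t ht => ?_⟩
  · refine (hV t ht).2.2.2.1.trans ?_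
    gcongr
    simp only [hf]
    linarith [sq_nonneg ‖Z t‖]
  · have := (hV t ht).2.1
    simp only [hf]
    linarith [sq_nonneg ‖y t‖]
  -- The monotone function `N` dominates `(Φ - Ψ)² / (2γ)`, which bounds the adaptive gain.
  · have h1 := sub_le_mul_sub_of_hasDerivWithinAt_le (f := N) (c := 0) ht
      (fun u hu => (hNd u hu.1).mono Icc_subset_Ici_self)
      fun u hu => (hNf u hu.1.le).trans (neg_nonpos.2 (hf0 u hu.1.le))
    have h2 := hN0 t ht
    have h3 : |Φ t - Ψ| ≤ √(2 * C.γ * N 0) := by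
      refine Real.abs_le_sqrt ?_
      rw [one_div, inv_mul_le_iff₀ (by positivity)] at h2
      refine h2.trans ?_
      gcongr
      linarith
    have h4 := abs_add_le (Φ t - Ψ) Ψ
    rw [sub_add_cancel] at h4
    linarith

/-- The control input vanishes with the errors. -/
theorem Motion.control_tendsto_zero (hF : ∀ i j, LocallyLipschitz fun ξ => F ξ i j)
    (hC : C.Admissible) (hσ : BoundedSignal σ) (hρb : BoundedSignal ρ)
    (hρ : ∀ t ∈ Ici (0 : ℝ), ∀ i : Fin d,
      HasDerivWithinAt (fun τ => ρ τ i.castSucc) (ρ t i.succ) (Ici 0) t)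
    (hρtop : ∀ t ∈ Ici (0 : ℝ), HasDerivWithinAt (fun τ => ρ τ (Fin.last d))
      (mv (F (ρ t)) θ + σ t) (Ici 0) t)
    (hm : Motion F θ σ C ρ (Ici 0) X Z Θ Φ) :
    BoundedSignal (fun t => -(C.k • Z t) + feedback F C (X t) (ρ t) (Θ t) (Φ t)) ∧
      Tendsto (fun t => -(C.k • Z t) + feedback F C (X t) (ρ t) (Θ t) (Φ t)) atTop (𝓝 0) := by
  obtain ⟨hE, hZ, M, hM⟩ := hm.tendsto_zero hF hC hσ hρb hρ hρtop
  obtain ⟨R, hR, hb⟩ := hm.exists_bound hF hC hσ hρb hρ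
  obtain ⟨L, hL0, hL⟩ := exists_norm_sub_mv_le hF R
  have hk := hC.k_pos
  have hε := hC.ε_pos
  have hκ := hC.κ_pos
  have hM0 : 0 ≤ M := (abs_nonneg _).trans (hM 0 (mem_Ici.2 le_rfl))
  set Q := 1 + ∑ i, |C.coef i|
  have hQ0 : 0 ≤ Q := by positivity
  -- The three terms of `η` in turn. Near zero the saturation is linear, `‖sat(y/ε)‖ ≤ ‖y‖/ε`, so
  -- even the term with gain at least `κ` is `O(‖X - ρ‖)`.
  set A := ∑ i, |C.coef i| + M * Q + (L * (R + R) * R + C.κ) * (Q / C.ε) with hA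
  have hA0 : 0 ≤ A := by positivity
  have hu : ∀ t ∈ Ici (0 : ℝ), ‖-(C.k • Z t) + feedback F C (X t) (ρ t) (Θ t) (Φ t)‖ ≤
      C.k * ‖Z t‖ + A * ‖X t - ρ t‖ := fun t ht => by
    obtain ⟨hX, -, hΘ, hρR⟩ := hb t ht
    have hy := norm_slide_le C.coef (X t - ρ t)
    have h1 : ‖∑ i : Fin d, C.coef i • (X t - ρ t) i.succ‖ ≤
        (∑ i, |C.coef i|) * ‖X t - ρ t‖ := by
      rw [Finset.sum_mul]
      refine (norm_sum_le _ _).trans (Finset.sum_le_sum fun i _ => ?_)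
      rw [norm_smul, Real.norm_eq_abs]
      gcongr
      exact norm_le_pi_norm (X t - ρ t) _
    have h2 : ‖Φ t • slide C.coef (X t - ρ t)‖ ≤ M * (Q * ‖X t - ρ t‖) := by
      rw [norm_smul, Real.norm_eq_abs]
      gcongr
      exact hM t ht
    have h3 : ‖(‖mv (F (X t) - F (ρ t)) (Θ t)‖ + C.κ) • satVec C.ε (slide C.coef (X t - ρ t))‖ ≤
        (L * (R + R) * R + C.κ) * (Q * ‖X t - ρ t‖ / C.ε) := by
      rw [norm_smul, Real.norm_of_nonneg (by positivity)]
      gcongr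
      · refine (hL _ _ hX hρR _).trans ?_
        gcongr
        exact (norm_sub_le _ _).trans (add_le_add hX hρR)
      · refine (norm_satVec_le hε _).trans ?_
        gcongr
    have h4 : ‖feedback F C (X t) (ρ t) (Θ t) (Φ t)‖ ≤ A * ‖X t - ρ t‖ := by
      rw [feedback]
      refine (norm_sub_le _ _).trans ((add_le_add ((norm_sub_le _ _).trans (add_le_add
        ((norm_neg _).trans_le h1) h2)) h3).trans (le_of_eq ?_))
      rw [hA]; ring
    refine (norm_add_le _ _).trans (add_le_add ?_ h4)
    rw [norm_neg, norm_smul, Real.norm_of_nonneg hk.le]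
  refine ⟨⟨C.k * R + A * (R + R), fun t ht => (hu t ht).trans ?_⟩, ?_⟩
  · obtain ⟨hX, hZR, -, hρR⟩ := hb t ht
    gcongr
    exact (norm_sub_le _ _).trans (add_le_add hX hρR)
  · refine squeeze_zero_norm' (a := fun t => C.k * ‖Z t‖ + A * ‖X t - ρ t‖) ?_ ?_
    · filter_upwards [eventually_ge_atTop 0] with t ht
      exact hu t ht
    · simpa using (hZ.norm.const_mul C.k).add (hE.norm.const_mul A)

end Convergence

/-! ### Constant tracking errors need nonzero control -/

section Equilibria

variable {d p m : ℕ} {F : State (d + 1) p → Matrix (Fin p) (Fin m) ℝ} {θ : Vec m}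
  {σ : ℝ → Vec p} {C : Params (d + 1) m} {r x : ℝ → Vec p} {θhat : ℝ → Vec m} {φ : ℝ → ℝ}

/-- Only `λ_1 E_0` survives in the combination (for `d = 0`, `E_0` itself), and `λ_1 > 0`. -/
theorem eq_zero_of_slide_eq_zero {lam : Fin d → ℝ} (hlam : ∀ i, 0 < lam i)
    {E : State (d + 1) p} (hE : ∀ i : Fin d, E i.succ = 0) (h : slide lam E = 0) : E = 0 := by
  have h0 : E 0 = 0 := by
    cases d with
    | zero => simpa [slide] using h
    | succ d =>
      have hlast : E (Fin.last (d + 1)) = 0 := hE (Fin.last d)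
      rw [slide, Fin.sum_univ_succ, hlast] at h
      simpa [hE, (hlam 0).ne'] using h
  funext i
  exact Fin.cases h0 hE i

theorem feedback_self (ξ : State (d + 1) p) (θh : Vec m) (φ : ℝ) :
    feedback F C ξ ξ θh φ = 0 := by
  simp [feedback, slide_zero, satVec_zero]

/-- A constant tracking error of a reference which is no response needs a nonzero control. -/
theorem IsClosedLoop.exists_control_ne_zero (hF : ∀ i j, LocallyLipschitz fun ξ => F ξ i j)
    (hσ : ContinuousOn σ (Ici 0)) (hσb : BoundedSignal σ) (hC : C.Admissible)
    (hr : ContDiffOn ℝ (d + 1 : ℕ) r (Ici 0)) (hrb : BoundedSignal (state (d + 1) r))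
    (h : IsClosedLoop F σ C r x θhat φ θ) (hnr : ¬ IsResponse F θ σ r) {ebar : State (d + 1) p}
    (he : ∀ t : ℝ, 0 ≤ t → state (d + 1) (err r x) t = ebar) :
    ∃ t : ℝ, 0 ≤ t ∧ control F σ C r x θhat φ t ≠ 0 := by
  by_contra! hu
  have hx := h.contDiffOn
  have hm := h.motion hF hσ hr
  have hρ : ∀ t ∈ Ici (0 : ℝ), ∀ i : Fin d, HasDerivWithinAt
      (fun τ => state (d + 1) r τ i.castSucc) (state (d + 1) r t i.succ) (Ici 0) t :=
    fun t ht i => hasDerivWithinAt_der hr (Nat.lt_succ_of_lt i.2) ht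
  have hE : ∀ t ∈ Ici (0 : ℝ), state (d + 1) x t - state (d + 1) r t = ebar := fun t ht => by
    rw [← state_err hr hx ht]; exact he t ht
  -- Each higher block is the derivative of the constant block below it.
  have hsucc : ∀ i : Fin d, ebar i.succ = 0 := fun i => by
    have h0 : (0 : ℝ) ∈ Ici (0 : ℝ) := mem_Ici.2 le_rfl
    have h1 := (hm.chain 0 h0 i).sub (hρ 0 h0 i)
    have h2 : HasDerivWithinAt (fun τ => state (d + 1) x τ i.castSucc -
        state (d + 1) r τ i.castSucc) 0 (Ici 0) 0 :=
      (hasDerivWithinAt_const 0 (Ici 0) (ebar i.castSucc)).congr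
        (fun t ht => congrFun (hE t ht) i.castSucc) (congrFun (hE 0 h0) i.castSucc)
    rw [← hE 0 h0]
    exact (uniqueDiffOn_Ici (0 : ℝ) 0 h0).eq_deriv _ h1 h2
  by_cases hy : slide C.coef ebar = 0
  · have h0 := eq_zero_of_slide_eq_zero (fun i => hC.lam_pos i) hsucc hy
    rw [h0] at hE
    have hst : ∀ t ∈ Ici (0 : ℝ), state (d + 1) x t = state (d + 1) r t := fun t ht =>
      sub_eq_zero.1 (hE t ht)
    have hxr : EqOn r x (Ici 0) := fun t ht => by
      have := congrFun (hst t ht) 0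
      simpa only [state, Fin.val_zero, der_zero] using this.symm
    refine hnr ⟨hr, fun t ht => ?_⟩
    rw [der_congr hxr _ ht, h.plant t ht, hu t ht, add_zero, hst t ht]
  · obtain ⟨R, hR, hb⟩ := hm.exists_bound hF hC hσb hrb hρ
    set ybar := slide C.coef ebar with hybar
    have hyp : 0 < ‖ybar‖ := norm_pos_iff.2 hy
    have hγ := hC.γ_pos
    have hk := hC.k_pos
    -- Pairing `u' = 0` with `ybar`: the saturation term has a favorable sign and `Z` is bounded, so
    -- `φ` is bounded above.
    have hle : ∀ t ∈ Ici (0 : ℝ), φ t * ‖ybar‖ ^ 2 ≤ C.k * (‖ybar‖ * R) := fun t ht => by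
      have h1 := hu t ht
      rw [control, eta_eq hr hx ht, feedback, hE t ht, ← hybar,
        Finset.sum_eq_zero fun i _ => by rw [hsucc i, smul_zero]] at h1
      have h2 := congrArg (inner ℝ ybar) h1
      simp only [inner_add_right, inner_sub_right, inner_neg_right, inner_smul_right,
        real_inner_self_eq_norm_sq, inner_zero_right] at h2
      have h3 : 0 ≤ (‖mv (F (state (d + 1) x t) - F (state (d + 1) r t)) (θhat t)‖ + C.κ) *
          inner ℝ ybar (satVec C.ε ybar) :=
        mul_nonneg (add_nonneg (norm_nonneg _) hC.κ_pos.le) (inner_satVec_nonneg hC.ε_pos _)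
      have h4 : C.k * -inner ℝ ybar (auxErr F σ C r x θhat φ t) ≤ C.k * (‖ybar‖ * R) := by
        rw [← inner_neg_left, ← norm_neg ybar]
        gcongr
        refine (real_inner_le_norm _ _).trans ?_
        gcongr
        exact (hb t ht).2.1
      linarith
    have hgrow : ∀ t ∈ Ici (0 : ℝ), φ 0 + C.γ * ‖ybar‖ ^ 2 * t ≤ φ t := fun t ht =>
      hm.gain_le hC ht fun u hu => by rw [hE u hu.1.le]
    set b := C.k * (‖ybar‖ * R) / ‖ybar‖ ^ 2
    -- By this time the linear growth has carried `φ` above the bound `b`.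
    set t := (|φ 0| + |b| + 1) / (C.γ * ‖ybar‖ ^ 2) with ht
    have ht0 : 0 ≤ t := by positivity
    have h1 : φ t ≤ b := (le_div_iff₀ (by positivity)).2 (hle t ht0)
    have h2 := hgrow t ht0
    have h3 : C.γ * ‖ybar‖ ^ 2 * t = |φ 0| + |b| + 1 := by
      rw [ht]; field_simp
    linarith [neg_abs_le (φ 0), le_abs_self b]

/-- The auxiliary error starts at the top block of the tracking error, which is zero, and is
constant by assumption; `η` vanishes when the state equals the reference state. -/
theorem IsClosedLoop.control_eq_zero_of_err_eq_zero
    (hr : ContDiffOn ℝ (d + 1 : ℕ) r (Ici 0)) (h : IsClosedLoop F σ C r x θhat φ θ)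
    {zbar : Vec p} (he : IsErrorEquilibrium F σ C r x θhat φ 0 zbar) {t : ℝ} (ht : 0 ≤ t) :
    control F σ C r x θhat φ t = 0 := by
  have hx := h.contDiffOn
  have h0 : (0 : ℝ) ∈ Ici (0 : ℝ) := mem_Ici.2 le_rfl
  have hz : zbar = 0 := by
    rw [← (he 0 le_rfl).2, auxErr_zero, ← der_err hr hx (Nat.le_succ d) h0]
    exact congrFun (he 0 le_rfl).1 (Fin.last d)
  have hst : state (d + 1) x t = state (d + 1) r t := by
    rw [← sub_eq_zero, ← state_err hr hx ht]
    exact (he t ht).1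
  rw [control, (he t ht).2, hz, eta_eq hr hx ht, hst, feedback_self, smul_zero, neg_zero,
    add_zero]

end Equilibria

end AdaptiveTracking

/-! ### The main theorem -/

theorem theorem1 {n p m : ℕ} (hn : 1 ≤ n)
    (F : AdaptiveTracking.State n p → Matrix (Fin p) (Fin m) ℝ)
    (hF : ∀ i j, LocallyLipschitz fun ξ => F ξ i j)
    (θ : AdaptiveTracking.Vec m)
    (σ : ℝ → AdaptiveTracking.Vec p)
    (hσ : ContinuousOn σ (Ici 0)) (hσb : AdaptiveTracking.BoundedSignal σ)
    (C : AdaptiveTracking.Params n m) (hC : C.Admissible)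
    (r : ℝ → AdaptiveTracking.Vec p)
    (hr : ContDiffOn ℝ n r (Ici 0))
    (hrb : AdaptiveTracking.BoundedSignal (AdaptiveTracking.state n r)) :
    -- from every initial state the closed loop has a motion on all of `[0, ∞)`
    (∀ (ξ₀ : AdaptiveTracking.State n p) (θ₀ : AdaptiveTracking.Vec m) (φ₀ : ℝ),
      ∃ (x : ℝ → AdaptiveTracking.Vec p) (θhat : ℝ → AdaptiveTracking.Vec m) (φ : ℝ → ℝ),
        AdaptiveTracking.IsClosedLoop F σ C r x θhat φ θ ∧
          AdaptiveTracking.state n x 0 = ξ₀ ∧ θhat 0 = θ₀ ∧ φ 0 = φ₀) ∧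
    -- every motion of the closed loop behaves as follows
    ∀ (x : ℝ → AdaptiveTracking.Vec p) (θhat : ℝ → AdaptiveTracking.Vec m) (φ : ℝ → ℝ),
      AdaptiveTracking.IsClosedLoop F σ C r x θhat φ θ →
      -- the reference is a natural response: tracking, with bounded noninvasive control
      (∀ xstar : ℝ → AdaptiveTracking.Vec p,
        AdaptiveTracking.IsResponse F θ σ xstar →
        (∀ t : ℝ, 0 ≤ t → AdaptiveTracking.state n r t = AdaptiveTracking.state n xstar t) →
        Tendsto (fun t => AdaptiveTracking.state n x t - AdaptiveTracking.state n xstar t)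
            atTop (𝓝 0) ∧
          AdaptiveTracking.BoundedSignal (AdaptiveTracking.control F σ C r x θhat φ) ∧
          Tendsto (AdaptiveTracking.control F σ C r x θhat φ) atTop (𝓝 0)) ∧
      -- the reference is not a response
      (¬ AdaptiveTracking.IsResponse F θ σ r →
        AdaptiveTracking.BoundedSignal (AdaptiveTracking.state n x) ∧
        (∀ (ebar : AdaptiveTracking.State n p) (zbar : AdaptiveTracking.Vec p),
          AdaptiveTracking.IsErrorEquilibrium F σ C r x θhat φ ebar zbar →
            ebar ≠ 0 ∧ ∃ t : ℝ, 0 ≤ t ∧ AdaptiveTracking.control F σ C r x θhat φ t ≠ 0) ∧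
        -- the control input is nonzero even if only the tracking error is at rest
        (∀ ebar : AdaptiveTracking.State n p,
          (∀ t : ℝ, 0 ≤ t →
            AdaptiveTracking.state n (AdaptiveTracking.err r x) t = ebar) →
            ∃ t : ℝ, 0 ≤ t ∧ AdaptiveTracking.control F σ C r x θhat φ t ≠ 0)) := by
  obtain ⟨d, rfl⟩ : ∃ d, n = d + 1 := ⟨n - 1, by omega⟩
  have hρ : ∀ t ∈ Ici (0 : ℝ), ∀ i : Fin d, HasDerivWithinAt
      (fun τ => AdaptiveTracking.state (d + 1) r τ i.castSucc)
      (AdaptiveTracking.state (d + 1) r t i.succ) (Ici 0) t :=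
    fun t ht i => AdaptiveTracking.hasDerivWithinAt_der hr (Nat.lt_succ_of_lt i.2) ht
  refine ⟨fun ξ₀ θ₀ φ₀ => ?_, fun x θhat φ h => ⟨fun xstar hstar heq => ?_, fun hnr => ⟨?_, ?_, ?_⟩⟩⟩
  · obtain ⟨X, Z, Θ, Φ, hm, hX, hZ, hΘ, hΦ⟩ := AdaptiveTracking.exists_motion (θ := θ) hF hC hσ
      hσb hrb (AdaptiveTracking.continuousOn_state hr) hρ ξ₀
      -- The initial auxiliary error is not free: it must equal `e^{(n-1)}(0)`.
      (ξ₀ (Fin.last d) - AdaptiveTracking.der d r 0) θ₀ φ₀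
    obtain ⟨hcl, hst⟩ := hm.isClosedLoop hF hσ hr (by rw [hZ, hX])
    exact ⟨_, Θ, Φ, hcl, (hst (mem_Ici.2 le_rfl)).trans hX, hΘ, hΦ⟩
  · have hm := h.motion hF hσ hr
    -- The stacked states contain only derivatives up to order `n - 1`; equality of the signals
    -- themselves also identifies the derivatives of order `n`.
    have hrx : EqOn r xstar (Ici 0) := fun t ht => by
      have := congrFun (heq t ht) 0
      simpa only [AdaptiveTracking.state, Fin.val_zero, AdaptiveTracking.der_zero] using this
    have hρtop : ∀ t ∈ Ici (0 : ℝ), HasDerivWithinAt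
        (fun τ => AdaptiveTracking.state (d + 1) r τ (Fin.last d))
        (AdaptiveTracking.mv (F (AdaptiveTracking.state (d + 1) r t)) θ + σ t) (Ici 0) t :=
      fun t ht => by
        refine (AdaptiveTracking.hasDerivWithinAt_der hr (Nat.lt_succ_self d) ht).congr_deriv ?_
        rw [AdaptiveTracking.der_congr hrx _ ht, hstar.ode t ht, heq t ht]
    have hu : ∀ t ∈ Ici (0 : ℝ), AdaptiveTracking.control F σ C r x θhat φ t =
        -(C.k • AdaptiveTracking.auxErr F σ C r x θhat φ t) +
          AdaptiveTracking.feedback F C (AdaptiveTracking.state (d + 1) x t)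
            (AdaptiveTracking.state (d + 1) r t) (θhat t) (φ t) := fun t ht => by
      rw [AdaptiveTracking.control, AdaptiveTracking.eta_eq hr h.contDiffOn ht]
    obtain ⟨⟨M, hM⟩, hlim⟩ := hm.control_tendsto_zero hF hC hσb hrb hρ hρtop
    refine ⟨(hm.tendsto_zero hF hC hσb hrb hρ hρtop).1.congr' ?_, ⟨M, fun t ht => ?_⟩,
      hlim.congr' ?_⟩
    · filter_upwards [eventually_ge_atTop 0] with t ht
      rw [heq t ht]
    · rw [hu t ht]; exact hM t ht
    · filter_upwards [eventually_ge_atTop 0] with t ht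
      exact (hu t ht).symm
  · obtain ⟨R, -, hb⟩ := (h.motion hF hσ hr).exists_bound hF hC hσb hrb hρ
    exact ⟨R, fun t ht => (hb t ht).1⟩
  · intro ebar zbar he
    have hne := h.exists_control_ne_zero hF hσ hσb hC hr hrb hnr fun t ht => (he t ht).1
    refine ⟨?_, hne⟩
    rintro rfl
    obtain ⟨t, ht, hc⟩ := hne
    exact hc (h.control_eq_zero_of_err_eq_zero hr he ht)
  · exact fun ebar he => h.exists_control_ne_zero hF hσ hσb hC hr hrb hnr he
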